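/- Let $m,n$ be natural numbers. For a unital $*$-algebra $C$ let $S(C)$ be the set of states of $C$ (unital positive linear functionals), let $E_{ij}$ be the matrix units of $M_n(\mathbb{C})$, and let $\{\Lambda_{xy}\}_{x,y=1}^m$ be a family of maps $\Lambda_{xy}:S(M_n(\mathbb{C})\otimes M_n(\mathbb{C}))\to S(M_n(\mathbb{C})\otimes M_n(\mathbb{C}))$. The family is called a \emph{generalized unitary induced channel in the quantum tensor model} if there are Hilbert spaces $H_A,H_B$, a state $\phi\in S(B(H_A\otimes H_B))$ and unitaries $U^x\in M_n(B(H_A))=M_n(\mathbb{C})\otimes B(H_A)$, $V^y\in M_n(B(H_B))=B(H_B)\otimes M_n(\mathbb{C})$ ($x,y=1,\dots,m$) such that, in $M_n(\mathbb{C})\otimes B(H_A\otimes H_B)\otimes M_n(\mathbb{C})$, $$\Lambda_{xy}(\varphi)(g\otimes h)=(\varphi\otimes\phi)\bigl((U^x\otimes 1)(1\otimes V^y)(g\otimes 1\otimes h)(1\otimes (V^y)^*)((U^x)^*\otimes 1)\bigr)$$ for all $x,y$, all $\varphi\in S(M_n(\mathbb{C})\otimes M_n(\mathbb{C}))$ and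 all $g,h\in M_n(\mathbb{C})$, where $\varphi$ acts on the two outer tensor factors and $\phi$ on the middle one. Let $\mathcal{U}(n)$ be the Brown algebra, i.e. the universal unital C*-algebra generated by elements $u_{ij}$ ($i,j=1,\dots,n$) with $\sum_k u_{ik}u_{lk}^*=\delta_{il}1$ and $\sum_i u_{ik}^*u_{il}=\delta_{kl}1$. Let $*_{x=1}^m\,\mathcal{U}^x(n)$ be the unital full free product of $m$ copies of $\mathcal{U}(n)$, and let $\otimes_{\min}$ be the minimal tensor product of C*-algebras. The following conditions are equivalent. (1) $\{\Lambda_{xy}\}$ is a generalized unitary induced channel in the quantum tensor model. (2) There are unital C*-algebras $A,B$, a state $\tilde\phi\in S(A\otimes_{\min}B)$ and unitaries $U^x=(\tilde u^x_{ij})_{i,j}\in M_n(A)$, $V^y=(\tilde v^y_{kl})_{k,l}\in M_n(B)$ ($x,y=1,\dots,m$) such that for all $x,y$, all $\varphi\in S(M_n(\mathbb{C})\otimes M_n(\mathbb{C}))$ and all $g,h\in M_n(\mathbb{C})$ $$\Lambda_{xy}(\varphi)(g\otimes h)=\sum_{i,j,k,l,p,r,s,t=1}^n\varphi(E_{ij}gE_{kl}\otimes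 E_{pr}hE_{st})\,\tilde\phi\bigl(\tilde u^x_{ij}(\tilde u^x_{lk})^*\otimes\tilde v^y_{pr}(\tilde v^y_{ts})^*\bigr).$$ (3) There is a state $\phi\in S\bigl((*_{x=1}^m\,\mathcal{U}^x(n))\otimes_{\min}(*_{y=1}^m\,\mathcal{U}^y(n))\bigr)$ such that for all $x,y$, all $\varphi\in S(M_n(\mathbb{C})\otimes M_n(\mathbb{C}))$ and all $g,h\in M_n(\mathbb{C})$ $$\Lambda_{xy}(\varphi)(g\otimes h)=\sum_{i,j,k,l,p,r,s,t=1}^n\varphi(E_{ij}gE_{kl}\otimes E_{pr}hE_{st})\,\phi\bigl(u^x_{ij}(u^x_{lk})^*\otimes v^y_{pr}(v^y_{ts})^*\bigr),$$ where $u^x_{ij}$ and $v^y_{kl}$ are the generators of the $x$-th copy of $\mathcal{U}(n)$ in the first free product and of the $y$-th copy in the second. -/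

import Mathlib

open scoped TensorProduct ComplexOrder InnerProductSpace

noncomputable section

set_option linter.unusedSectionVars false

/-! ### States -/

/-- A state on a unital complex star-algebra `C`: a unital positive linear functional. In a
C*-algebra (and in a matrix algebra) the positive elements are exactly those of the form
`star x * x`. -/
structure QState (C : Type*) [Ring C] [StarRing C] [Algebra ℂ C] extends C →ₗ[ℂ] ℂ where
  map_one' : toFun 1 = 1
  nonneg' : ∀ x : C, 0 ≤ toFun (star x * x)

instance QState.instCoeFun (C : Type*) [Ring C] [StarRing C] [Algebra ℂ C] :
    CoeFun (QState C) (fun _ => C → ℂ) where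
  coe φ := φ.toLinearMap

/-! ### C*-seminorms and C*-completions -/

/-- A C*-seminorm on a unital complex star-algebra. -/
structure CStarSeminorm (F : Type*) [Ring F] [StarRing F] [Algebra ℂ F] extends
    Seminorm ℂ F where
  mul_le' : ∀ x y : F, toFun (x * y) ≤ toFun x * toFun y
  star_mul_self' : ∀ x : F, toFun (star x * x) = toFun x * toFun x

namespace CStarSeminorm

section Basic

variable {F : Type*} [Ring F] [StarRing F] [Algebra ℂ F]

instance instCoeFun : CoeFun (CStarSeminorm F) (fun _ => F → ℝ) where
  coe p := p.toSeminorm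

theorem mul_le (p : CStarSeminorm F) (x y : F) : p (x * y) ≤ p x * p y := p.mul_le' x y

theorem star_mul_self (p : CStarSeminorm F) (x : F) : p (star x * x) = p x * p x :=
  p.star_mul_self' x

theorem nonneg (p : CStarSeminorm F) (x : F) : 0 ≤ p x := apply_nonneg p.toSeminorm x

theorem le_star (p : CStarSeminorm F) (x : F) : p x ≤ p (star x) := by
  have h := p.mul_le (star x) x
  rw [p.star_mul_self] at h
  rcases (p.nonneg x).eq_or_lt with h0 | h0
  · rw [← h0]; exact p.nonneg _
  · exact le_of_mul_le_mul_right h h0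

theorem star_eq (p : CStarSeminorm F) (x : F) : p (star x) = p x :=
  le_antisymm (by simpa using p.le_star (star x)) (p.le_star x)

/-- The C*-seminorm `x ↦ ‖f x‖` of a star-homomorphism into a C*-algebra. -/
def ofStarAlgHom {D : Type*} [NormedRing D] [StarRing D] [CStarRing D] [NormedAlgebra ℂ D]
    (f : F →⋆ₐ[ℂ] D) : CStarSeminorm F where
  toSeminorm := (normSeminorm ℂ D).comp f.toAlgHom.toLinearMap
  mul_le' x y := by
    change ‖f (x * y)‖ ≤ ‖f x‖ * ‖f y‖
    rw [map_mul]; exact norm_mul_le _ _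
  star_mul_self' x := by
    change ‖f (star x * x)‖ = ‖f x‖ * ‖f x‖
    rw [map_mul, map_star, CStarRing.norm_star_mul_self]

theorem ofStarAlgHom_apply {D : Type*} [NormedRing D] [StarRing D] [CStarRing D] [NormedAlgebra ℂ D]
    (f : F →⋆ₐ[ℂ] D) (x : F) :
    ofStarAlgHom f x = ‖f x‖ := rfl

/-- The pointwise supremum of a pointwise bounded set of C*-seminorms. -/
def supremum (S : Set (CStarSeminorm F))
    (hS : ∀ x, BddAbove (Set.range fun p : S => p.1 x)) : CStarSeminorm F where
  toFun x := ⨆ p : S, p.1 x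
  map_zero' := by
    have : ∀ p : S, p.1 (0 : F) = 0 := fun p => map_zero p.1.toSeminorm
    simp [this]
  add_le' x y := by
    refine Real.iSup_le (fun p => ?_) (add_nonneg
      (Real.iSup_nonneg fun p => p.1.nonneg x) (Real.iSup_nonneg fun p => p.1.nonneg y))
    exact (map_add_le_add p.1.toSeminorm x y).trans
      (add_le_add (le_ciSup (hS x) p) (le_ciSup (hS y) p))
  neg' x := by
    have : ∀ p : S, p.1 (-x) = p.1 x := fun p => map_neg_eq_map p.1.toSeminorm x
    simp [this]
  smul' c x := by
    have : ∀ p : S, p.1 (c • x) = ‖c‖ * p.1 x := fun p => map_smul_eq_mul p.1.toSeminorm c x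
    simp only [this]
    rw [Real.mul_iSup_of_nonneg (norm_nonneg c)]
  mul_le' x y := by
    refine Real.iSup_le (fun p => ?_) (mul_nonneg
      (Real.iSup_nonneg fun p => p.1.nonneg x) (Real.iSup_nonneg fun p => p.1.nonneg y))
    exact (p.1.mul_le x y).trans (mul_le_mul (le_ciSup (hS x) p) (le_ciSup (hS y) p)
      (p.1.nonneg y) (Real.iSup_nonneg fun p => p.1.nonneg x))
  star_mul_self' x := by
    have h0 : 0 ≤ ⨆ p : S, p.1 x := Real.iSup_nonneg fun p => p.1.nonneg x
    apply le_antisymm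
    · refine Real.iSup_le (fun p => ?_) (mul_nonneg h0 h0)
      rw [p.1.star_mul_self]
      exact mul_le_mul (le_ciSup (hS x) p) (le_ciSup (hS x) p) (p.1.nonneg x) h0
    · have h1 : 0 ≤ ⨆ p : S, p.1 (star x * x) := Real.iSup_nonneg fun p => p.1.nonneg _
      rw [← Real.sqrt_le_sqrt_iff h1, Real.sqrt_mul_self h0]
      refine Real.iSup_le (fun p => ?_) (Real.sqrt_nonneg _)
      refine Real.le_sqrt_of_sq_le ?_
      rw [sq, ← p.1.star_mul_self]
      exact le_ciSup (hS (star x * x)) p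

theorem le_supremum {S : Set (CStarSeminorm F)}
    (hS : ∀ x, BddAbove (Set.range fun p : S => p.1 x)) {p : CStarSeminorm F} (hp : p ∈ S)
    (x : F) : p x ≤ supremum S hS x :=
  le_ciSup (hS x) (⟨p, hp⟩ : S)

theorem supremum_le {S : Set (CStarSeminorm F)}
    (hS : ∀ x, BddAbove (Set.range fun p : S => p.1 x)) {x : F} {c : ℝ} (hc : 0 ≤ c)
    (h : ∀ p ∈ S, p x ≤ c) : supremum S hS x ≤ c :=
  Real.iSup_le (fun p => h p.1 p.2) hc

end Basic

section Completion

variable {F : Type*} [Ring F] [StarRing F] [Algebra ℂ F] [StarModule ℂ F]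

/-- The star-algebra `F`, seminormed by `p`. -/
@[nolint unusedArguments]
def Carrier (_p : CStarSeminorm F) : Type _ := F

variable (p : CStarSeminorm F)

instance instSeminormedRingCarrier : SeminormedRing p.Carrier where
  __ := (inferInstance : Ring F)
  __ := AddGroupSeminorm.toSeminormedAddCommGroup (E := F) p.toAddGroupSeminorm
  norm_mul_le := p.mul_le

instance instStarRingCarrier : StarRing p.Carrier := (inferInstance : StarRing F)

instance instNormedAlgebraCarrier : NormedAlgebra ℂ p.Carrier where
  __ := (inferInstance : Algebra ℂ F)
  norm_smul_le c x := (map_smul_eq_mul p.toSeminorm c x).le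

instance instStarModuleCarrier : StarModule ℂ p.Carrier := (inferInstance : StarModule ℂ F)

instance instNormedStarGroupCarrier : NormedStarGroup p.Carrier where
  norm_star_le x := (p.star_eq x).le

/-- The identity of `F`, as a map to the seminormed copy of `F`. -/
def toCarrier : F →⋆ₐ[ℂ] p.Carrier := StarAlgHom.id ℂ F

theorem norm_toCarrier (x : F) : ‖p.toCarrier x‖ = p x := rfl

/-- The C*-algebra obtained from `F` by dividing out the null space of `p` and completing. -/
def Completion : Type _ := UniformSpace.Completion p.Carrier

namespace Completion

instance instNormedRing : NormedRing p.Completion :=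
  inferInstanceAs (NormedRing (UniformSpace.Completion p.Carrier))

instance instCompleteSpace : CompleteSpace p.Completion :=
  inferInstanceAs (CompleteSpace (UniformSpace.Completion p.Carrier))

instance instNormedAlgebra : NormedAlgebra ℂ p.Completion where
  __ := (inferInstance : Algebra ℂ (UniformSpace.Completion p.Carrier))
  norm_smul_le c x :=
    (inferInstance : NormedSpace ℂ (UniformSpace.Completion p.Carrier)).norm_smul_le c x

/-- The canonical map on underlying sets. -/
def coe (x : p.Carrier) : p.Completion := (x : UniformSpace.Completion p.Carrier)

theorem norm_coe (x : p.Carrier) : ‖coe p x‖ = ‖x‖ := UniformSpace.Completion.norm_coe x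

theorem isometry_coe : Isometry (coe p) := UniformSpace.Completion.coe_isometry

theorem denseRange_coe : DenseRange (coe p) := UniformSpace.Completion.denseRange_coe

theorem coe_mul (x y : p.Carrier) : coe p (x * y) = coe p x * coe p y :=
  UniformSpace.Completion.coe_mul x y

theorem coe_add (x y : p.Carrier) : coe p (x + y) = coe p x + coe p y :=
  UniformSpace.Completion.coe_add x y

theorem coe_smul (c : ℂ) (x : p.Carrier) : coe p (c • x) = c • coe p x :=
  UniformSpace.Completion.coe_smul c x

/-- The star operation of the completion is the continuous extension of that of `F`. -/
instance instStar : Star p.Completion :=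
  ⟨UniformSpace.Completion.map (star : p.Carrier → p.Carrier)⟩

theorem continuous_star' : Continuous (star : p.Completion → p.Completion) :=
  UniformSpace.Completion.continuous_map

theorem star_coe (x : p.Carrier) : star (coe p x) = coe p (star x) :=
  UniformSpace.Completion.map_coe star_isometry.uniformContinuous x

theorem induction {P : p.Completion → Prop} (x : p.Completion) (hP : IsClosed {x | P x})
    (h : ∀ a, P (coe p a)) : P x :=
  UniformSpace.Completion.induction_on x hP h

instance instStarRing : StarRing p.Completion where
  star_involutive x := by
    have hc := continuous_star' p
    refine induction p (P := fun x => star (star x) = x) x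
      (isClosed_eq (by fun_prop) (by fun_prop)) fun a => ?_
    rw [star_coe, star_coe, star_star]
  star_mul x y := by
    have hc := continuous_star' p
    refine induction p (P := fun x => star (x * y) = star y * star x) x
      (isClosed_eq (by fun_prop) (by fun_prop)) fun a => ?_
    refine induction p (P := fun y => star (coe p a * y) = star y * star (coe p a)) y
      (isClosed_eq (by fun_prop) (by fun_prop)) fun b => ?_
    rw [← coe_mul, star_coe, star_coe, star_coe, star_mul, coe_mul]
  star_add x y := by
    have hc := continuous_star' p
    refine induction p (P := fun x => star (x + y) = star x + star y) x
      (isClosed_eq (by fun_prop) (by fun_prop)) fun a => ?_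
    refine induction p (P := fun y => star (coe p a + y) = star (coe p a) + star y) y
      (isClosed_eq (by fun_prop) (by fun_prop)) fun b => ?_
    rw [← coe_add, star_coe, star_coe, star_coe, star_add, coe_add]

theorem star_smul_completion (c : ℂ) (x : p.Completion) : star (c • x) = star c • star x := by
  have hc := continuous_star' p
  have h1 : Continuous fun x : p.Completion => star (c • x) :=
    hc.comp (continuous_const_smul c)
  have h2 : Continuous fun x : p.Completion => star c • star x :=
    (continuous_const_smul (star c)).comp hc
  refine induction p (P := fun x => star (c • x) = star c • star x) x
    (isClosed_eq h1 h2) fun a => ?_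
  rw [← coe_smul, star_coe, star_coe, star_smul, coe_smul]

instance instCStarAlgebra : CStarAlgebra p.Completion where
  norm_mul_self_le x := by
    have hc := continuous_star' p
    refine induction p (P := fun x => ‖x‖ * ‖x‖ ≤ ‖star x * x‖) x
      (isClosed_le (by fun_prop) (by fun_prop)) fun a => ?_
    rw [star_coe, ← coe_mul, norm_coe, norm_coe]
    exact (p.star_mul_self a).ge
  star_smul := star_smul_completion p

theorem coe_zero : coe p 0 = 0 := UniformSpace.Completion.coe_zero

theorem coe_one : coe p 1 = 1 := UniformSpace.Completion.coe_one p.Carrier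

theorem coe_algebraMap (c : ℂ) : coe p (algebraMap ℂ p.Carrier c) = algebraMap ℂ _ c := by
  rw [Algebra.algebraMap_eq_smul_one, coe_smul, coe_one, ← Algebra.algebraMap_eq_smul_one]

/-- The canonical star-homomorphism from `F` to the C*-completion. -/
def mk : F →⋆ₐ[ℂ] p.Completion where
  toFun x := coe p (p.toCarrier x)
  map_one' := (congrArg (coe p) (map_one p.toCarrier)).trans (coe_one p)
  map_mul' x y := (congrArg (coe p) (map_mul p.toCarrier x y)).trans (coe_mul p _ _)
  map_zero' := (congrArg (coe p) (map_zero p.toCarrier)).trans (coe_zero p)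
  map_add' x y := (congrArg (coe p) (map_add p.toCarrier x y)).trans (coe_add p _ _)
  commutes' c := (congrArg (coe p) (AlgHomClass.commutes p.toCarrier c)).trans (coe_algebraMap p c)
  map_star' x := (congrArg (coe p) (map_star p.toCarrier x)).trans (star_coe p _).symm

theorem norm_mk (x : F) : ‖mk p x‖ = p x := norm_coe p _

theorem denseRange_mk : DenseRange (mk p) := denseRange_coe p

end Completion

end Completion

end CStarSeminorm

/-! ### Universal C*-algebras given by generators and relations -/

/-- The free unital complex star-algebra on a set `G` of generators: noncommutative polynomials in
the letters `g` (left summand) and `g*` (right summand). -/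
def FreeStarAlgebra (G : Type*) : Type _ := FreeAlgebra ℂ (G ⊕ G)

namespace FreeStarAlgebra

variable {G : Type*}

instance instRing : Ring (FreeStarAlgebra G) := inferInstanceAs (Ring (FreeAlgebra ℂ (G ⊕ G)))
instance instAlgebra : Algebra ℂ (FreeStarAlgebra G) :=
  inferInstanceAs (Algebra ℂ (FreeAlgebra ℂ (G ⊕ G)))

/-- The letters `g` and `g*`. -/
def letter (s : G ⊕ G) : FreeStarAlgebra G := FreeAlgebra.ι ℂ s

/-- The generators. -/
def gen (g : G) : FreeStarAlgebra G := letter (Sum.inl g)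

theorem induction {P : FreeStarAlgebra G → Prop} (hs : ∀ c : ℂ, P (algebraMap ℂ _ c))
    (hl : ∀ s, P (letter s)) (hm : ∀ x y, P x → P y → P (x * y))
    (ha : ∀ x y, P x → P y → P (x + y)) (x : FreeStarAlgebra G) : P x :=
  FreeAlgebra.induction (motive := P) ℂ (G ⊕ G) hs hl hm ha x

/-- The antimultiplicative, conjugate-linear map that exchanges `g` and `g*`, as a ring
homomorphism to the opposite ring. -/
def starHom : FreeStarAlgebra G →+* (FreeStarAlgebra G)ᵐᵒᵖ :=
  letI : Algebra ℂ (FreeStarAlgebra G)ᵐᵒᵖ := RingHom.toAlgebra'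
    ((algebraMap ℂ (FreeStarAlgebra G)ᵐᵒᵖ).comp (starRingEnd ℂ))
    fun c x => Algebra.commutes (starRingEnd ℂ c) x
  (FreeAlgebra.lift ℂ fun s : G ⊕ G => MulOpposite.op (letter s.swap)).toRingHom

theorem starHom_letter (s : G ⊕ G) : starHom (letter s) = MulOpposite.op (letter s.swap) := by
  let _ : Algebra ℂ (FreeStarAlgebra G)ᵐᵒᵖ := RingHom.toAlgebra'
    ((algebraMap ℂ (FreeStarAlgebra G)ᵐᵒᵖ).comp (starRingEnd ℂ))
    fun c x => Algebra.commutes (starRingEnd ℂ c) x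
  exact FreeAlgebra.lift_ι_apply (R := ℂ) (fun s : G ⊕ G => MulOpposite.op (letter s.swap)) s

theorem starHom_algebraMap (c : ℂ) : starHom (algebraMap ℂ (FreeStarAlgebra G) c) =
    MulOpposite.op (algebraMap ℂ (FreeStarAlgebra G) (starRingEnd ℂ c)) := by
  let _ : Algebra ℂ (FreeStarAlgebra G)ᵐᵒᵖ := RingHom.toAlgebra'
    ((algebraMap ℂ (FreeStarAlgebra G)ᵐᵒᵖ).comp (starRingEnd ℂ))
    fun c x => Algebra.commutes (starRingEnd ℂ c) x
  exact AlgHom.commutes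
    (FreeAlgebra.lift ℂ fun s : G ⊕ G => MulOpposite.op (letter s.swap)) c

instance instStarRing : StarRing (FreeStarAlgebra G) where
  star x := (starHom x).unop
  star_involutive x := by
    change (starHom (starHom x).unop).unop = x
    induction x using induction with
    | hs c => simp [starHom_algebraMap]
    | hl s => simp [starHom_letter]
    | hm x y hx hy => simp [hx, hy]
    | ha x y hx hy => simp [hx, hy]
  star_mul x y := by
    change (starHom (x * y)).unop = (starHom y).unop * (starHom x).unop
    simp
  star_add x y := by
    change (starHom (x + y)).unop = (starHom x).unop + (starHom y).unop
    simp

theorem star_letter (s : G ⊕ G) : star (letter s) = letter s.swap := by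
  change (starHom (letter s)).unop = _
  rw [starHom_letter]; rfl

instance instStarModule : StarModule ℂ (FreeStarAlgebra G) where
  star_smul c x := by
    rw [Algebra.smul_def, star_mul]
    change star x * (starHom (algebraMap ℂ _ c)).unop = _
    rw [starHom_algebraMap, Algebra.smul_def, Algebra.commutes]; rfl

end FreeStarAlgebra

section Universal

variable {G : Type*}

/-- The C*-seminorms on the free star-algebra for which all relators `r ∈ R` are null. They are
exactly the seminorms `x ↦ ‖ρ x‖` of star-homomorphisms `ρ` to unital C*-algebras that kill `R`. -/
def relSeminorms (R : Set (FreeStarAlgebra G)) : Set (CStarSeminorm (FreeStarAlgebra G)) :=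
  {p | ∀ r ∈ R, p r = 0}

/-- Relations are admissible if they bound the norm of each generator. -/
def AdmissibleRel (R : Set (FreeStarAlgebra G)) : Prop :=
  ∀ g : G, ∃ c : ℝ, ∀ p ∈ relSeminorms R, p (FreeStarAlgebra.gen g) ≤ c

theorem AdmissibleRel.bddAbove {R : Set (FreeStarAlgebra G)} (hR : AdmissibleRel R)
    (x : FreeStarAlgebra G) : BddAbove (Set.range fun p : relSeminorms R => p.1 x) := by
  suffices h : ∃ c : ℝ, ∀ p ∈ relSeminorms R, p x ≤ c by
    obtain ⟨c, hc⟩ := h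
    exact ⟨c, by rintro _ ⟨p, rfl⟩; exact hc p.1 p.2⟩
  induction x using FreeStarAlgebra.induction with
  | hs c =>
    refine ⟨‖c‖, fun p _ => ?_⟩
    have h1 : p 1 ≤ 1 := by
      have h := p.star_mul_self 1
      rw [star_one, one_mul] at h
      nlinarith [p.nonneg 1]
    rw [Algebra.algebraMap_eq_smul_one, map_smul_eq_mul p.toSeminorm]
    exact mul_le_of_le_one_right (norm_nonneg c) h1
  | hl s =>
    rcases s with g | g
    · exact hR g
    · obtain ⟨c, hc⟩ := hR g
      refine ⟨c, fun p hp => ?_⟩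
      have h : FreeStarAlgebra.letter (Sum.inr g) = star (FreeStarAlgebra.gen g) :=
        (FreeStarAlgebra.star_letter (Sum.inl g)).symm
      rw [h, p.star_eq]
      exact hc p hp
  | hm x y hx hy =>
    obtain ⟨c, hc⟩ := hx
    obtain ⟨d, hd⟩ := hy
    refine ⟨c * d, fun p hp => (p.mul_le x y).trans ?_⟩
    exact mul_le_mul (hc p hp) (hd p hp) (p.nonneg y) ((p.nonneg x).trans (hc p hp))
  | ha x y hx hy =>
    obtain ⟨c, hc⟩ := hx
    obtain ⟨d, hd⟩ := hy
    exact ⟨c + d, fun p hp => (map_add_le_add p.toSeminorm x y).trans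
      (add_le_add (hc p hp) (hd p hp))⟩

/-- The largest C*-seminorm compatible with the relations. -/
def universalSeminorm (R : Set (FreeStarAlgebra G)) (hR : AdmissibleRel R) :
    CStarSeminorm (FreeStarAlgebra G) :=
  CStarSeminorm.supremum (relSeminorms R) hR.bddAbove

/-- The universal unital C*-algebra with generators `G` and relations `r = 0`, `r ∈ R`. -/
abbrev UniversalCStarAlgebra (R : Set (FreeStarAlgebra G)) (hR : AdmissibleRel R) : Type _ :=
  (universalSeminorm R hR).Completion

/-- The canonical map from the free star-algebra to the universal C*-algebra. -/
abbrev UniversalCStarAlgebra.mk (R : Set (FreeStarAlgebra G)) (hR : AdmissibleRel R) :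
    FreeStarAlgebra G →⋆ₐ[ℂ] UniversalCStarAlgebra R hR :=
  CStarSeminorm.Completion.mk (universalSeminorm R hR)

theorem UniversalCStarAlgebra.mk_rel {R : Set (FreeStarAlgebra G)} (hR : AdmissibleRel R)
    {r : FreeStarAlgebra G} (hr : r ∈ R) : UniversalCStarAlgebra.mk R hR r = 0 := by
  rw [← norm_eq_zero, CStarSeminorm.Completion.norm_mk]
  exact le_antisymm (CStarSeminorm.supremum_le _ le_rfl fun p hp => (hp r hr).le)
    (CStarSeminorm.nonneg _ _)

end Universal

/-! ### The Brown algebra -/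

section Brown

/-- The relations that say that the matrix of generators is unitary. -/
def brownRel (n : ℕ) : Set (FreeStarAlgebra (Fin n × Fin n)) :=
  {r | ∃ i l : Fin n, r = ∑ k, FreeStarAlgebra.gen (i, k) * star (FreeStarAlgebra.gen (l, k)) -
      if i = l then 1 else 0} ∪
  {r | ∃ k l : Fin n, r = ∑ i, star (FreeStarAlgebra.gen (i, k)) * FreeStarAlgebra.gen (i, l) -
      if k = l then 1 else 0}

theorem norm_le_one_of_sum_mul_star {D ι : Type*} [CStarAlgebra D] [Fintype ι] (w : ι → D)
    (h : ∑ k, w k * star (w k) = 1) (k : ι) : ‖w k‖ ≤ 1 := by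
  let _ : PartialOrder D := CStarAlgebra.spectralOrder D
  have _ : StarOrderedRing D := CStarAlgebra.spectralOrderedRing D
  have h1 : w k * star (w k) ≤ 1 := by
    rw [← h]
    exact Finset.single_le_sum (f := fun k => w k * star (w k))
      (fun j _ => mul_star_self_nonneg (w j)) (Finset.mem_univ k)
  have h2 := CStarAlgebra.norm_le_norm_of_nonneg_of_le (mul_star_self_nonneg (w k)) h1
  rw [CStarRing.norm_self_mul_star] at h2
  have h3 : ‖(1 : D)‖ ≤ 1 := by
    have h := CStarRing.norm_star_mul_self (x := (1 : D))
    rw [star_one, one_mul] at h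
    nlinarith [norm_nonneg (1 : D)]
  nlinarith [norm_nonneg (w k)]

theorem brownRel_admissible (n : ℕ) : AdmissibleRel (brownRel n) := by
  rintro ⟨i, k⟩
  refine ⟨1, fun p hp => ?_⟩
  let q := CStarSeminorm.Completion.mk p
  have h : q (∑ k, FreeStarAlgebra.gen (i, k) * star (FreeStarAlgebra.gen (i, k)) -
      if i = i then 1 else 0) = 0 := by
    rw [← norm_eq_zero, CStarSeminorm.Completion.norm_mk]
    exact hp _ (Or.inl ⟨i, i, rfl⟩)
  have h' : ∑ k, q (FreeStarAlgebra.gen (i, k)) * star (q (FreeStarAlgebra.gen (i, k))) = 1 := by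
    rw [if_pos rfl, map_sub, map_sum, map_one, sub_eq_zero] at h
    simpa only [map_mul, map_star] using h
  rw [← CStarSeminorm.Completion.norm_mk]
  exact norm_le_one_of_sum_mul_star (fun k => q (FreeStarAlgebra.gen (i, k))) h' k

/-- The Brown algebra `𝒰(n)`: the universal unital C*-algebra generated by the entries of a unitary
`n × n` matrix. -/
abbrev BrownAlgebra (n : ℕ) : Type :=
  UniversalCStarAlgebra (brownRel n) (brownRel_admissible n)

/-- The generators `u i j` of the Brown algebra. -/
def BrownAlgebra.u {n : ℕ} (i j : Fin n) : BrownAlgebra n :=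
  UniversalCStarAlgebra.mk (brownRel n) (brownRel_admissible n) (FreeStarAlgebra.gen (i, j))

end Brown

/-! ### The unital full free product of C*-algebras -/

section FreeProduct

variable {I : Type*} (A : I → Type*) [∀ i, CStarAlgebra (A i)]

/-- The relations that say that each `A i` is mapped by a unital star-homomorphism. -/
inductive FreeProdRel : FreeStarAlgebra (Σ i, A i) → Prop
  | add (i : I) (a b : A i) : FreeProdRel (FreeStarAlgebra.gen ⟨i, a + b⟩ -
      (FreeStarAlgebra.gen ⟨i, a⟩ + FreeStarAlgebra.gen ⟨i, b⟩))
  | smul (i : I) (c : ℂ) (a : A i) : FreeProdRel (FreeStarAlgebra.gen ⟨i, c • a⟩ -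
      c • FreeStarAlgebra.gen ⟨i, a⟩)
  | mul (i : I) (a b : A i) : FreeProdRel (FreeStarAlgebra.gen ⟨i, a * b⟩ -
      FreeStarAlgebra.gen ⟨i, a⟩ * FreeStarAlgebra.gen ⟨i, b⟩)
  | star (i : I) (a : A i) : FreeProdRel (FreeStarAlgebra.gen ⟨i, star a⟩ -
      star (FreeStarAlgebra.gen ⟨i, a⟩))
  | one (i : I) : FreeProdRel (FreeStarAlgebra.gen ⟨i, 1⟩ - 1)

/-- A star-homomorphism from the free star-algebra on the disjoint union of the `A i` to a
C*-algebra that kills the relations restricts to a unital star-homomorphism on each `A i`. -/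
def freeProdRestrict {D : Type*} [CStarAlgebra D] (q : FreeStarAlgebra (Σ i, A i) →⋆ₐ[ℂ] D)
    (hq : ∀ r, FreeProdRel A r → q r = 0) (i : I) : A i →⋆ₐ[ℂ] D where
  toFun a := q (FreeStarAlgebra.gen ⟨i, a⟩)
  map_one' := by simpa [sub_eq_zero] using hq _ (FreeProdRel.one i)
  map_mul' a b := by simpa [sub_eq_zero] using hq _ (FreeProdRel.mul i a b)
  map_zero' := by simpa [sub_eq_zero] using hq _ (FreeProdRel.smul i 0 0)
  map_add' a b := by simpa only [map_sub, map_add, sub_eq_zero] using hq _ (FreeProdRel.add i a b)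
  commutes' c := by
    have h1 : q (FreeStarAlgebra.gen ⟨i, 1⟩) = 1 := by
      simpa [sub_eq_zero] using hq _ (FreeProdRel.one i)
    have h2 := hq _ (FreeProdRel.smul i c 1)
    rw [map_sub, map_smul, h1, sub_eq_zero] at h2
    rw [Algebra.algebraMap_eq_smul_one, h2, Algebra.algebraMap_eq_smul_one]
  map_star' a := by
    simpa only [map_sub, map_star, sub_eq_zero] using hq _ (FreeProdRel.star i a)

theorem freeProdRel_admissible : AdmissibleRel {r | FreeProdRel A r} := by
  rintro ⟨i, a⟩
  refine ⟨‖a‖, fun p hp => ?_⟩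
  have hq : ∀ r, FreeProdRel A r → CStarSeminorm.Completion.mk p r = 0 := fun r hr => by
    rw [← norm_eq_zero, CStarSeminorm.Completion.norm_mk]
    exact hp r hr
  rw [← CStarSeminorm.Completion.norm_mk]
  exact NonUnitalStarAlgHom.norm_apply_le (freeProdRestrict A _ hq i) a

/-- The unital full free product of a family of unital C*-algebras. -/
abbrev CStarFreeProduct : Type _ :=
  UniversalCStarAlgebra {r | FreeProdRel A r} (freeProdRel_admissible A)

/-- The canonical star-homomorphism of the factor `A i` to the free product. -/
def CStarFreeProduct.of (i : I) : A i →⋆ₐ[ℂ] CStarFreeProduct A :=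
  freeProdRestrict A (UniversalCStarAlgebra.mk _ (freeProdRel_admissible A))
    (fun _ hr => UniversalCStarAlgebra.mk_rel (freeProdRel_admissible A) hr) i

end FreeProduct

/-! ### Hilbert tensor products -/

section HilbertTensor

variable (H : Type*) [NormedAddCommGroup H] [InnerProductSpace ℂ H]
  (K : Type*) [NormedAddCommGroup K] [InnerProductSpace ℂ K]

/-- The Hilbert space tensor product: the completion of the algebraic tensor product with
`⟪a ⊗ b, c ⊗ d⟫ = ⟪a, c⟫ * ⟪b, d⟫`. -/
abbrev HilbertTensor : Type _ := UniformSpace.Completion (H ⊗[ℂ] K)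

variable {H K}

/-- The operator `S ⊗ T` on the Hilbert space tensor product. -/
def opTensor (S : H →L[ℂ] H) (T : K →L[ℂ] K) : HilbertTensor H K →L[ℂ] HilbertTensor H K :=
  (TensorProduct.mapL S T).completion

theorem opTensor_coe (S : H →L[ℂ] H) (T : K →L[ℂ] K) (x : H ⊗[ℂ] K) :
    opTensor S T (x : HilbertTensor H K) = (TensorProduct.mapL S T x : H ⊗[ℂ] K) :=
  ContinuousLinearMap.completion_apply_coe _ _

theorem opTensor_ext {P Q : HilbertTensor H K →L[ℂ] HilbertTensor H K}
    (h : ∀ x : H ⊗[ℂ] K, P (x : HilbertTensor H K) = Q (x : HilbertTensor H K)) : P = Q := by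
  ext z
  induction z using UniformSpace.Completion.induction_on with
  | hp => exact isClosed_eq P.continuous Q.continuous
  | ih x => exact h x

theorem opTensor_mul (S S' : H →L[ℂ] H) (T T' : K →L[ℂ] K) :
    opTensor (S * S') (T * T') = opTensor S T * opTensor S' T' :=
  opTensor_ext fun x => by
    rw [mul_apply_eq_comp, opTensor_coe, opTensor_coe, opTensor_coe,
      TensorProduct.mapL_mul, mul_apply_eq_comp]

theorem opTensor_one : opTensor (1 : H →L[ℂ] H) (1 : K →L[ℂ] K) = 1 :=
  opTensor_ext fun x => by
    rw [opTensor_coe]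
    exact congrArg _ (DFunLike.congr_fun (TensorProduct.mapL_id_id (𝕜 := ℂ) (E := H) (G := K)) x)

theorem opTensor_add_left (S S' : H →L[ℂ] H) (T : K →L[ℂ] K) :
    opTensor (S + S') T = opTensor S T + opTensor S' T :=
  opTensor_ext fun x => by
    rw [add_apply, opTensor_coe, opTensor_coe, opTensor_coe,
      TensorProduct.mapL_add_left, add_apply, UniformSpace.Completion.coe_add]

theorem opTensor_add_right (S : H →L[ℂ] H) (T T' : K →L[ℂ] K) :
    opTensor S (T + T') = opTensor S T + opTensor S T' :=
  opTensor_ext fun x => by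
    rw [add_apply, opTensor_coe, opTensor_coe, opTensor_coe,
      TensorProduct.mapL_add_right, add_apply, UniformSpace.Completion.coe_add]

theorem opTensor_smul_left (c : ℂ) (S : H →L[ℂ] H) (T : K →L[ℂ] K) :
    opTensor (c • S) T = c • opTensor S T :=
  opTensor_ext fun x => by
    rw [smul_apply, opTensor_coe, opTensor_coe,
      TensorProduct.mapL_smul_left, smul_apply, UniformSpace.Completion.coe_smul]

theorem opTensor_smul_right (c : ℂ) (S : H →L[ℂ] H) (T : K →L[ℂ] K) :
    opTensor S (c • T) = c • opTensor S T :=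
  opTensor_ext fun x => by
    rw [smul_apply, opTensor_coe, opTensor_coe,
      TensorProduct.mapL_smul_right, smul_apply, UniformSpace.Completion.coe_smul]

theorem opTensor_star [CompleteSpace H] [CompleteSpace K] (S : H →L[ℂ] H) (T : K →L[ℂ] K) :
    opTensor (star S) (star T) = star (opTensor S T) := by
  rw [ContinuousLinearMap.star_eq_adjoint (opTensor S T), ContinuousLinearMap.eq_adjoint_iff]
  intro x y
  induction x, y using UniformSpace.Completion.induction_on₂ with
  | hp =>
    exact isClosed_eq
      (((opTensor (star S) (star T)).continuous.comp continuous_fst).inner continuous_snd)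
      (continuous_fst.inner ((opTensor S T).continuous.comp continuous_snd))
  | ih x y =>
    rw [opTensor_coe, opTensor_coe, UniformSpace.Completion.inner_coe,
      UniformSpace.Completion.inner_coe]
    induction x with
    | zero => simp
    | add x x' hx hx' => simp only [map_add, inner_add_left, hx, hx']
    | tmul a b =>
      induction y with
      | zero => simp
      | add y y' hy hy' => simp only [map_add, inner_add_right, hy, hy']
      | tmul c d =>
        simp only [TensorProduct.mapL_tmul, TensorProduct.inner_tmul,
          ContinuousLinearMap.star_eq_adjoint, ContinuousLinearMap.adjoint_inner_left]

variable (H K) in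
/-- `S ↦ S ⊗ 1`. -/
def ampLeft [CompleteSpace H] [CompleteSpace K] :
    (H →L[ℂ] H) →⋆ₐ[ℂ] (HilbertTensor H K →L[ℂ] HilbertTensor H K) where
  toFun S := opTensor S 1
  map_one' := opTensor_one
  map_mul' S S' := by rw [← opTensor_mul, one_mul]
  map_zero' := by simpa using opTensor_smul_left (0 : ℂ) (0 : H →L[ℂ] H) (1 : K →L[ℂ] K)
  map_add' S S' := opTensor_add_left S S' 1
  commutes' c := by
    rw [Algebra.algebraMap_eq_smul_one, Algebra.algebraMap_eq_smul_one, opTensor_smul_left,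
      opTensor_one]
  map_star' S := by rw [← opTensor_star, star_one]

variable (H K) in
/-- `T ↦ 1 ⊗ T`. -/
def ampRight [CompleteSpace H] [CompleteSpace K] :
    (K →L[ℂ] K) →⋆ₐ[ℂ] (HilbertTensor H K →L[ℂ] HilbertTensor H K) where
  toFun T := opTensor 1 T
  map_one' := opTensor_one
  map_mul' T T' := by rw [← opTensor_mul, one_mul]
  map_zero' := by simpa using opTensor_smul_right (0 : ℂ) (1 : H →L[ℂ] H) (0 : K →L[ℂ] K)
  map_add' T T' := opTensor_add_right 1 T T'
  commutes' c := by
    rw [Algebra.algebraMap_eq_smul_one, Algebra.algebraMap_eq_smul_one, opTensor_smul_right,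
      opTensor_one]
  map_star' T := by rw [← opTensor_star, star_one]

theorem ampLeft_mul_ampRight [CompleteSpace H] [CompleteSpace K] (S : H →L[ℂ] H)
    (T : K →L[ℂ] K) : ampLeft H K S * ampRight H K T = opTensor S T :=
  (opTensor_mul S 1 1 T).symm.trans (by rw [mul_one, one_mul])

theorem ampRight_mul_ampLeft [CompleteSpace H] [CompleteSpace K] (S : H →L[ℂ] H)
    (T : K →L[ℂ] K) : ampRight H K T * ampLeft H K S = opTensor S T :=
  (opTensor_mul 1 S T 1).symm.trans (by rw [mul_one, one_mul])

end HilbertTensor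

/-! ### The minimal tensor product -/

section MinTensor

universe u v w

section ProductRep

variable {A B : Type*} [CStarAlgebra A] [CStarAlgebra B]

/-- The star-homomorphism `a ⊗ b ↦ f a * g b` given by two commuting star-homomorphisms. -/
def tensorLift {D : Type*} [Ring D] [StarRing D] [Algebra ℂ D] (f : A →⋆ₐ[ℂ] D) (g : B →⋆ₐ[ℂ] D)
    (hc : ∀ a b, Commute (f a) (g b)) : A ⊗[ℂ] B →⋆ₐ[ℂ] D where
  toAlgHom := Algebra.TensorProduct.lift f.toAlgHom g.toAlgHom hc
  map_star' x := by
    change Algebra.TensorProduct.lift f.toAlgHom g.toAlgHom hc (star x) =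
      star (Algebra.TensorProduct.lift f.toAlgHom g.toAlgHom hc x)
    induction x with
    | zero => rw [star_zero, map_zero, star_zero]
    | add x y hx hy => rw [star_add, map_add, hx, hy, map_add, star_add]
    | tmul a b =>
      rw [TensorProduct.star_tmul, Algebra.TensorProduct.lift_tmul,
        Algebra.TensorProduct.lift_tmul, star_mul]
      change f (star a) * g (star b) = star (g b) * star (f a)
      rw [(hc (star a) (star b)).eq, map_star, map_star]

theorem tensorLift_tmul {D : Type*} [Ring D] [StarRing D] [Algebra ℂ D] (f : A →⋆ₐ[ℂ] D) (g : B →⋆ₐ[ℂ] D)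
    (hc : ∀ a b, Commute (f a) (g b)) (a : A) (b : B) :
    tensorLift f g hc (a ⊗ₜ b) = f a * g b :=
  Algebra.TensorProduct.lift_tmul f.toAlgHom g.toAlgHom hc a b

variable {H : Type*} [NormedAddCommGroup H] [InnerProductSpace ℂ H] [CompleteSpace H]
  {K : Type*} [NormedAddCommGroup K] [InnerProductSpace ℂ K] [CompleteSpace K]

/-- The representation `π ⊗ σ` of the algebraic tensor product `A ⊗ B` on the Hilbert space tensor
product, `(π ⊗ σ) (a ⊗ b) = π a ⊗ σ b`. -/
def productRep (π : A →⋆ₐ[ℂ] (H →L[ℂ] H)) (σ : B →⋆ₐ[ℂ] (K →L[ℂ] K)) :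
    A ⊗[ℂ] B →⋆ₐ[ℂ] (HilbertTensor H K →L[ℂ] HilbertTensor H K) :=
  tensorLift (D := HilbertTensor H K →L[ℂ] HilbertTensor H K)
    ((ampLeft H K).comp π) ((ampRight H K).comp σ)
    fun a b => (ampLeft_mul_ampRight (π a) (σ b)).trans (ampRight_mul_ampLeft (π a) (σ b)).symm

theorem productRep_tmul (π : A →⋆ₐ[ℂ] (H →L[ℂ] H)) (σ : B →⋆ₐ[ℂ] (K →L[ℂ] K)) (a : A) (b : B) :
    productRep π σ (a ⊗ₜ b) = opTensor (π a) (σ b) := by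
  rw [← ampLeft_mul_ampRight]
  exact tensorLift_tmul (D := HilbertTensor H K →L[ℂ] HilbertTensor H K) _ _ _ a b

end ProductRep

variable (A : Type u) [CStarAlgebra A] (B : Type v) [CStarAlgebra B]

/-- The C*-seminorms `x ↦ ‖(π ⊗ σ) x‖` on the algebraic tensor product, for representations `π` of
`A` and `σ` of `B` on Hilbert spaces. The universe `w` allows these spaces to be taken from a larger
universe than the algebras; it does not affect the supremum of the seminorms. -/
def spatialSeminorms : Set (CStarSeminorm (A ⊗[ℂ] B)) :=
  {p | ∃ (H : Type (max u w)) (_ : NormedAddCommGroup H) (_ : InnerProductSpace ℂ H)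
    (_ : CompleteSpace H) (K : Type (max v w)) (_ : NormedAddCommGroup K)
    (_ : InnerProductSpace ℂ K) (_ : CompleteSpace K)
    (π : A →⋆ₐ[ℂ] (H →L[ℂ] H)) (σ : B →⋆ₐ[ℂ] (K →L[ℂ] K)),
    p = CStarSeminorm.ofStarAlgHom
      (D := HilbertTensor H K →L[ℂ] HilbertTensor H K) (productRep π σ)}

theorem spatialSeminorms_bddAbove (x : A ⊗[ℂ] B) :
    BddAbove (Set.range fun p : spatialSeminorms.{u, v, w} A B => p.1 x) := by
  suffices h : ∃ c : ℝ, ∀ p ∈ spatialSeminorms.{u, v, w} A B, p x ≤ c by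
    obtain ⟨c, hc⟩ := h
    exact ⟨c, by rintro _ ⟨p, rfl⟩; exact hc p.1 p.2⟩
  induction x with
  | zero => exact ⟨0, fun p _ => (map_zero p.toSeminorm).le⟩
  | add x y hx hy =>
    obtain ⟨c, hc⟩ := hx
    obtain ⟨d, hd⟩ := hy
    exact ⟨c + d, fun p hp => (map_add_le_add p.toSeminorm x y).trans
      (add_le_add (hc p hp) (hd p hp))⟩
  | tmul a b =>
    refine ⟨‖a‖ * ‖b‖, ?_⟩
    rintro _ ⟨H, _, _, _, K, _, _, _, π, σ, rfl⟩
    have h1 : ‖ampLeft H K (π a)‖ ≤ ‖a‖ :=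
      NonUnitalStarAlgHom.norm_apply_le (B := HilbertTensor H K →L[ℂ] HilbertTensor H K)
        ((ampLeft H K).comp π) a
    have h2 : ‖ampRight H K (σ b)‖ ≤ ‖b‖ :=
      NonUnitalStarAlgHom.norm_apply_le (B := HilbertTensor H K →L[ℂ] HilbertTensor H K)
        ((ampRight H K).comp σ) b
    have h3 : ‖productRep π σ (a ⊗ₜ b)‖ ≤ ‖a‖ * ‖b‖ := by
      rw [productRep_tmul, ← ampLeft_mul_ampRight]
      refine (norm_mul_le (ampLeft H K (π a)) (ampRight H K (σ b))).trans ?_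
      gcongr
    exact h3

/-- The minimal (spatial) C*-norm: the supremum of `‖(π ⊗ σ) x‖` over all representations. -/
def minSeminorm : CStarSeminorm (A ⊗[ℂ] B) :=
  CStarSeminorm.supremum (spatialSeminorms.{u, v, w} A B)
    (spatialSeminorms_bddAbove.{u, v, w} A B)

/-- The minimal tensor product of unital C*-algebras: the completion of the algebraic tensor product
in the minimal C*-norm. -/
abbrev MinTensor : Type (max u v) := (minSeminorm.{u, v, w} A B).Completion

variable {A B} in
/-- The elementary tensor `a ⊗ b` in the minimal tensor product. -/
def MinTensor.tmul (a : A) (b : B) : MinTensor.{u, v, w} A B :=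
  CStarSeminorm.Completion.mk (minSeminorm.{u, v, w} A B) (a ⊗ₜ[ℂ] b)

end MinTensor

/-! ### Generalized unitary induced channels in the tensor model -/

section Channels

variable {n : ℕ}

/-- The algebra `M_n(ℂ) ⊗ M_n(ℂ)` of the two ancillas. -/
abbrev Ancilla (n : ℕ) : Type :=
  Matrix (Fin n) (Fin n) ℂ ⊗[ℂ] Matrix (Fin n) (Fin n) ℂ

/-- The algebra `M_n(ℂ) ⊗ C ⊗ M_n(ℂ)` of the whole system. -/
abbrev WholeSystem (n : ℕ) (C : Type*) [CStarAlgebra C] : Type _ :=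
  (Matrix (Fin n) (Fin n) ℂ ⊗[ℂ] C) ⊗[ℂ] Matrix (Fin n) (Fin n) ℂ

/-- The functional `φ ⊗ ψ` on `M_n(ℂ) ⊗ C ⊗ M_n(ℂ)`, where `φ` acts on the two outer factors:
`(φ ⊗ ψ) (a ⊗ c ⊗ b) = φ (a ⊗ b) * ψ c`. -/
def wholeState {C : Type*} [CStarAlgebra C] (φ : QState (Ancilla n)) (ψ : QState C) :
    WholeSystem n C →ₗ[ℂ] ℂ :=
  LinearMap.mul' ℂ ℂ ∘ₗ TensorProduct.map φ.toLinearMap ψ.toLinearMap ∘ₗ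
    (TensorProduct.rightComm ℂ (Matrix (Fin n) (Fin n) ℂ) C
      (Matrix (Fin n) (Fin n) ℂ)).toLinearMap

variable {H : Type*} [NormedAddCommGroup H] [InnerProductSpace ℂ H] [CompleteSpace H]
  {K : Type*} [NormedAddCommGroup K] [InnerProductSpace ℂ K] [CompleteSpace K]

/-- `U ⊗ 1`, for `U = ∑ E i j ⊗ u i j` in `M_n(B(H))`: the element `∑ E i j ⊗ (u i j ⊗ 1) ⊗ 1` of
`M_n(ℂ) ⊗ B(H ⊗ K) ⊗ M_n(ℂ)`. -/
def aliceOp (K : Type*) [NormedAddCommGroup K] [InnerProductSpace ℂ K] [CompleteSpace K]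
    (U : Matrix (Fin n) (Fin n) (H →L[ℂ] H)) :
    WholeSystem n (HilbertTensor H K →L[ℂ] HilbertTensor H K) :=
  ∑ i, ∑ j, (Matrix.single i j (1 : ℂ) ⊗ₜ[ℂ] ampLeft H K (U i j)) ⊗ₜ[ℂ] 1

/-- `1 ⊗ V`, for `V = ∑ v k l ⊗ E k l` in `M_n(B(K))`: the element `∑ 1 ⊗ (1 ⊗ v k l) ⊗ E k l` of
`M_n(ℂ) ⊗ B(H ⊗ K) ⊗ M_n(ℂ)`. -/
def bobOp (H : Type*) [NormedAddCommGroup H] [InnerProductSpace ℂ H] [CompleteSpace H]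
    (V : Matrix (Fin n) (Fin n) (K →L[ℂ] K)) :
    WholeSystem n (HilbertTensor H K →L[ℂ] HilbertTensor H K) :=
  ∑ k, ∑ l, (1 ⊗ₜ[ℂ] ampRight H K (V k l)) ⊗ₜ[ℂ] Matrix.single k l (1 : ℂ)

/-- The family `Λ` is a generalized unitary induced channel in the quantum tensor model. -/
def IsGeneralizedUnitaryInducedTensor.{u} (m n : ℕ)
    (Λ : Fin m → Fin m → QState (Ancilla n) → QState (Ancilla n)) : Prop :=
  ∃ (H : Type u) (_ : NormedAddCommGroup H) (_ : InnerProductSpace ℂ H) (_ : CompleteSpace H)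
    (K : Type u) (_ : NormedAddCommGroup K) (_ : InnerProductSpace ℂ K) (_ : CompleteSpace K)
    (ψ : QState (HilbertTensor H K →L[ℂ] HilbertTensor H K))
    (U : Fin m → Matrix (Fin n) (Fin n) (H →L[ℂ] H))
    (V : Fin m → Matrix (Fin n) (Fin n) (K →L[ℂ] K)),
    (∀ x, U x ∈ unitary (Matrix (Fin n) (Fin n) (H →L[ℂ] H))) ∧
    (∀ y, V y ∈ unitary (Matrix (Fin n) (Fin n) (K →L[ℂ] K))) ∧
    ∀ (x y : Fin m) (φ : QState (Ancilla n)) (g h : Matrix (Fin n) (Fin n) ℂ),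
      Λ x y φ (g ⊗ₜ[ℂ] h) =
        wholeState φ ψ (aliceOp K (U x) * bobOp H (V y) * ((g ⊗ₜ[ℂ] 1) ⊗ₜ[ℂ] h) *
          bobOp H (star (V y)) * aliceOp K (star (U x)))

/-- The channel formula: `Λ` is given by a state `ψ` on the minimal tensor product of `A` and `B`
and by families of matrices `U x` over `A` and `V y` over `B`. -/
def IsGivenByMinState.{u, v, w} {m n : ℕ} {A : Type u} [CStarAlgebra A] {B : Type v}
    [CStarAlgebra B] (Λ : Fin m → Fin m → QState (Ancilla n) → QState (Ancilla n))
    (ψ : QState (MinTensor.{u, v, w} A B)) (U : Fin m → Matrix (Fin n) (Fin n) A)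
    (V : Fin m → Matrix (Fin n) (Fin n) B) : Prop :=
  ∀ (x y : Fin m) (φ : QState (Ancilla n)) (g h : Matrix (Fin n) (Fin n) ℂ),
    Λ x y φ (g ⊗ₜ[ℂ] h) =
      ∑ i, ∑ j, ∑ k, ∑ l, ∑ p, ∑ r, ∑ s, ∑ t,
        φ ((Matrix.single i j 1 * g * Matrix.single k l 1) ⊗ₜ[ℂ]
            (Matrix.single p r 1 * h * Matrix.single s t 1)) *
          ψ (MinTensor.tmul (U x i j * star (U x l k)) (V y p r * star (V y t s)))

/-- The generator `u i j` of the `x`-th copy of the Brown algebra inside the free product of `m`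
copies. -/
def brownFreeGen (m n : ℕ) (x : Fin m) :
    Matrix (Fin n) (Fin n) (CStarFreeProduct fun _ : Fin m => BrownAlgebra n) :=
  Matrix.of fun i j =>
    CStarFreeProduct.of (fun _ : Fin m => BrownAlgebra n) x (BrownAlgebra.u i j)

end Channels

end

universe u

/-! The three conditions share one formula: the channel is determined by the numbers ψ(u u* ⊗ v v*),
where u, u* are entries of Alice's unitary and its adjoint, and v, v* are Bob's. The proof moves the
state ψ between algebras without changing these numbers. Pulling a state back along a unital
star-homomorphism is free; only one implication has to push a state forward.

(1) ⇒ (2). Expanding the products in M_n ⊗ B(H ⊗ K) ⊗ M_n into elementary tensors, φ sees the outer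
legs and ψ the middle one, where Bob's operators commute with Alice's (`wholeState_aliceOp_bobOp`).
The identity representations of B(H) and B(K) induce a star-homomorphism from B(H) ⊗_min B(K) to B(H
⊗ K), along which ψ is pulled back.

(2) ⇒ (3). The unitaries U^x induce star-homomorphisms from the Brown algebra to A, hence one from
the free product to A; similarly for B. The minimal tensor product is functorial (`MinTensor.map`),
and the state is pulled back along the tensor product of the two maps.

(3) ⇒ (1). The state must be carried to some B(H ⊗ K). A direct sum of sufficiently many
representations gives one pair π, σ for which π ⊗ σ is isometric on the minimal tensor product
(`exists_norm_productRep_eq`). A state has norm at most 1, so it extends from the image to B(H ⊗ K)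
by Hahn–Banach, and the extension is again a state because a unital functional of norm at most 1 is
positive (`QState.exists_comap_eq`). The images of the generators under π and σ are the required
unitaries. -/

noncomputable section

/-! ### States and star-homomorphisms -/

namespace QState

section Comap

variable {C D : Type*} [Ring C] [StarRing C] [Algebra ℂ C] [Ring D] [StarRing D] [Algebra ℂ D]

/-- The pullback of a state along a unital star-homomorphism. -/
def comap (f : C →⋆ₐ[ℂ] D) (ψ : QState D) : QState C where
  toLinearMap := ψ.toLinearMap ∘ₗ f.toAlgHom.toLinearMap
  map_one' := (congrArg ψ.toLinearMap (map_one f)).trans ψ.map_one'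
  nonneg' x := by
    have h := ψ.nonneg' (f x)
    rw [← map_star, ← map_mul] at h
    exact h

theorem comap_apply (f : C →⋆ₐ[ℂ] D) (ψ : QState D) (x : C) : ψ.comap f x = ψ (f x) := rfl

end Comap

section CStar

variable {C D : Type*} [CStarAlgebra C] [CStarAlgebra D]

/-- Cauchy–Schwarz for the GNS form ⟪a, b⟫ = ψ(a* b), applied to the vectors 1 and x. The order on
`C` is the spectral one, installed locally. -/
theorem norm_apply_le (ψ : QState C) (x : C) : ‖ψ x‖ ≤ ‖x‖ := by
  let _ : PartialOrder C := CStarAlgebra.spectralOrder C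
  have _ : StarOrderedRing C := CStarAlgebra.spectralOrderedRing C
  let f : C →ₚ[ℂ] ℂ := PositiveLinearMap.mk₀ ψ.toLinearMap fun a ha => by
    obtain ⟨b, rfl⟩ := CStarAlgebra.nonneg_iff_eq_star_mul_self.mp ha
    exact ψ.nonneg' b
  have hf : ∀ a, f a = ψ a := fun _ => rfl
  have h1 : f 1 = 1 := ψ.map_one'
  have hcs := norm_inner_le_norm (𝕜 := ℂ) (f.toPreGNS 1) (f.toPreGNS x)
  rw [PositiveLinearMap.preGNS_inner_def, f.ofPreGNS_toPreGNS, f.ofPreGNS_toPreGNS, star_one,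
    one_mul, hf] at hcs
  have hone : ‖f.toPreGNS 1‖ = 1 := by
    rw [PositiveLinearMap.preGNS_norm_def]; simp [h1]
  have hx : ‖f.toPreGNS x‖ ≤ ‖x‖ := by
    rw [PositiveLinearMap.preGNS_norm_def, f.ofPreGNS_toPreGNS]
    rw [Real.sqrt_le_left (norm_nonneg x)]
    -- The GNS norm of x is at most ‖x‖, because x* x ≤ ‖x* x‖ · 1 = ‖x‖² · 1 and ψ is positive and
    -- unital.
    have h := PositiveLinearMap.apply_le_of_isSelfAdjoint f (star x * x)
      (IsSelfAdjoint.star_mul_self x)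
    rw [Algebra.algebraMap_eq_smul_one, ← Complex.coe_smul, map_smul, h1,
      CStarRing.norm_star_mul_self] at h
    have h' := (Complex.le_def.mp h).1
    simpa [sq] using h'
  rw [hone, one_mul] at hcs
  exact hcs.trans hx

/-- Positivity comes from norm estimates alone: perturbing a self-adjoint b by an imaginary scalar
forces f(b) to be real, and comparing a ≥ 0 with ‖a‖ · 1 forces Re f(a) ≥ 0. This makes Hahn–Banach
extensions of states into states. -/
theorem exists_of_norm_le (f : C →ₗ[ℂ] ℂ) (h1 : f 1 = 1) (hf : ∀ x, ‖f x‖ ≤ ‖x‖) :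
    ∃ ψ : QState C, ψ.toLinearMap = f := by
  let _ : PartialOrder C := CStarAlgebra.spectralOrder C
  have _ : StarOrderedRing C := CStarAlgebra.spectralOrderedRing C
  have hn1 : ‖(1 : C)‖ ≤ 1 := by
    have h := CStarRing.norm_star_mul_self (x := (1 : C))
    rw [star_one, one_mul] at h
    nlinarith [norm_nonneg (1 : C)]
  have him : ∀ b : C, IsSelfAdjoint b → (f b).im = 0 := fun b hb => by
    -- With z = b + it one has |f(z)|² ≥ (Im f(b) + t)², while ‖z‖² ≤ ‖b‖² + t². The terms t²
    -- cancel, so a function affine in t stays bounded above.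
    have key : ∀ t : ℝ, (f b).im ^ 2 + 2 * (f b).im * t ≤ ‖b‖ ^ 2 := fun t => by
      let z : C := b + ((t : ℂ) * Complex.I) • 1
      have hz : star z * z = b * b + ((t : ℂ) ^ 2) • 1 := by
        simp only [z, star_add, hb.star_eq, star_smul, star_one, add_mul, mul_add, smul_mul_assoc,
          mul_smul_comm, mul_one, one_mul]
        have h1 : star ((t : ℂ) * Complex.I) = -((t : ℂ) * Complex.I) := by simp
        have h2 : (t : ℂ) ^ 2 = -((t : ℂ) * Complex.I) * ((t : ℂ) * Complex.I) := by
          linear_combination ((t : ℂ) ^ 2) * Complex.I_mul_I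
        rw [h1, h2]
        module
      have hzn : ‖z‖ * ‖z‖ ≤ ‖b‖ ^ 2 + t ^ 2 := by
        rw [← CStarRing.norm_star_mul_self, hz, sq ‖b‖]
        refine (norm_add_le _ _).trans (add_le_add (norm_mul_le _ _) ?_)
        rw [norm_smul, norm_pow, Complex.norm_real, Real.norm_eq_abs, sq_abs]
        exact mul_le_of_le_one_right (sq_nonneg t) hn1
      have hfz : f z = f b + (t : ℂ) * Complex.I := by
        simp [z, h1]
      have h2 := mul_self_le_mul_self (norm_nonneg _) (hf z)
      rw [hfz, ← sq, ← Complex.normSq_eq_norm_sq, Complex.normSq_apply] at h2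
      simp at h2
      nlinarith [mul_self_nonneg (f b).re]
    by_contra h0
    -- This t makes the linear term equal to ‖b‖² + 1, which exceeds the bound.
    have h := key ((‖b‖ ^ 2 + 1) / (2 * (f b).im))
    have h3 : 2 * (f b).im * ((‖b‖ ^ 2 + 1) / (2 * (f b).im)) = ‖b‖ ^ 2 + 1 := by
      field_simp
    nlinarith [sq_nonneg (f b).im]
  refine ⟨⟨f, h1, fun x => ?_⟩, rfl⟩
  have ha0 : 0 ≤ star x * x := star_mul_self_nonneg x
  set a := star x * x
  have ha : IsSelfAdjoint a := .of_nonneg ha0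
  -- From 0 ≤ ‖a‖ · 1 - a ≤ ‖a‖ · 1. Applying f gives |‖a‖ - Re f(a)| ≤ ‖a‖, hence Re f(a) ≥ 0.
  have hM : ‖algebraMap ℝ C ‖a‖ - a‖ ≤ ‖a‖ := by
    rw [CStarAlgebra.norm_le_iff_le_algebraMap _ (norm_nonneg a)
      (sub_nonneg.mpr ha.le_algebraMap_norm_self)]
    exact sub_le_self _ ha0
  have h := (Complex.abs_re_le_norm _).trans ((hf _).trans hM)
  rw [Algebra.algebraMap_eq_smul_one, ← Complex.coe_smul, map_sub, map_smul, h1] at h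
  have hre : 0 ≤ (f a).re := by
    simp at h
    linarith [(abs_le.mp h).2]
  exact Complex.le_def.mpr ⟨hre, (him a ha).symm⟩

/-- Hahn–Banach: an isometric ρ transports ψ to a functional of norm at most 1 on the range of ρ. A
norm-preserving extension to `D` still takes 1 = ρ(1) to 1, so it is a state. -/
theorem exists_comap_eq (ρ : C →⋆ₐ[ℂ] D) (hρ : ∀ x, ‖ρ x‖ = ‖x‖) (ψ : QState C) :
    ∃ χ : QState D, ∀ x, χ (ρ x) = ψ x := by
  have hinj : Function.Injective ρ.toAlgHom.toLinearMap := by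
    refine (injective_iff_map_eq_zero _).mpr fun x hx => ?_
    have h := hρ x
    rw [show ρ x = 0 from hx, norm_zero] at h
    exact norm_eq_zero.mp h.symm
  let e := LinearEquiv.ofInjective ρ.toAlgHom.toLinearMap hinj
  have he : ∀ x, ((e x : _) : D) = ρ x := fun _ => rfl
  let f : StrongDual ℂ (LinearMap.range ρ.toAlgHom.toLinearMap) :=
    (ψ.toLinearMap ∘ₗ e.symm.toLinearMap).mkContinuous 1 fun y => by
      obtain ⟨x, rfl⟩ := e.surjective y
      have : ‖e x‖ = ‖x‖ := hρ x
      rw [this, one_mul]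
      simpa using ψ.norm_apply_le x
  obtain ⟨g, hg, hgn⟩ := exists_extension_norm_eq _ f
  have hgρ : ∀ x, g (ρ x) = ψ x := fun x => by
    rw [← he, hg]
    simp [f]
  have hfn : ‖f‖ ≤ 1 := LinearMap.mkContinuous_norm_le _ zero_le_one _
  obtain ⟨χ, hχ⟩ := exists_of_norm_le g.toLinearMap
    (by
      have h := hgρ 1
      rw [map_one] at h
      exact h.trans ψ.map_one')
    (fun x => by simpa using g.le_of_opNorm_le (hgn.trans_le hfn) x)
  exact ⟨χ, fun x => by rw [hχ]; exact hgρ x⟩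

end CStar

end QState

/-! ### Extension of star-homomorphisms to C*-completions -/

namespace CStarSeminorm.Completion

variable {F : Type*} [Ring F] [StarRing F] [Algebra ℂ F] [StarModule ℂ F]
  {D : Type*} [CStarAlgebra D]

/-- The extension to the C*-completion of a star-homomorphism dominated by the seminorm. -/
def lift (p : CStarSeminorm F) (f : F →⋆ₐ[ℂ] D) (hf : ∀ x, ‖f x‖ ≤ p x) :
    p.Completion →⋆ₐ[ℂ] D :=
  let L : p.Completion →L[ℂ] D :=
    f.toAlgHom.toLinearMap.extendOfNorm (mk p).toAlgHom.toLinearMap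
  have hL : ∀ x, L (mk p x) = f x := fun x =>
    LinearMap.extendOfNorm_eq (e := (mk p).toAlgHom.toLinearMap) (denseRange_mk p)
      ⟨1, fun x => by rw [one_mul]; exact (hf x).trans_eq (norm_mk p x).symm⟩ x
  have h1 : L 1 = 1 := by rw [← map_one (mk p), hL, map_one]
  { toFun := L
    map_one' := h1
    map_mul' := fun x y => by
      refine (denseRange_mk p).induction_on₂ (p := fun x y => L (x * y) = L x * L y) ?_ ?_ x y
      · exact isClosed_eq (by fun_prop) (by fun_prop)
      · intro a b
        rw [← map_mul, hL, hL, hL, map_mul]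
    map_zero' := map_zero L
    map_add' := map_add L
    commutes' := fun c => by
      rw [Algebra.algebraMap_eq_smul_one, Algebra.algebraMap_eq_smul_one, map_smul, h1]
    map_star' := fun x => by
      refine (denseRange_mk p).induction_on (p := fun x => L (star x) = star (L x)) x ?_ ?_
      · exact isClosed_eq (by fun_prop) (by fun_prop)
      · intro a
        rw [← map_star, hL, hL, map_star] }

theorem lift_mk (p : CStarSeminorm F) (f : F →⋆ₐ[ℂ] D) (hf : ∀ x, ‖f x‖ ≤ p x) (x : F) :
    lift p f hf (mk p x) = f x :=
  LinearMap.extendOfNorm_eq (e := (mk p).toAlgHom.toLinearMap) (denseRange_mk p)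
    ⟨1, fun x => by rw [one_mul]; exact (hf x).trans_eq (norm_mk p x).symm⟩ x

theorem norm_lift (p : CStarSeminorm F) (f : F →⋆ₐ[ℂ] D) (hf : ∀ x, ‖f x‖ = p x)
    (x : p.Completion) : ‖lift p f (fun x => (hf x).le) x‖ = ‖x‖ := by
  have hc : Continuous (lift p f (fun x => (hf x).le)) :=
    AddMonoidHomClass.continuous_of_bound _ 1 fun x => by
      rw [one_mul]
      exact NonUnitalStarAlgHom.norm_apply_le (lift p f fun x => (hf x).le) x
  refine (denseRange_mk p).induction_on (p := fun x => ‖lift p f (fun x => (hf x).le) x‖ = ‖x‖)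
    x (isClosed_eq (by fun_prop) (by fun_prop)) fun a => ?_
  rw [lift_mk, hf, norm_mk]

end CStarSeminorm.Completion

/-! ### Universal properties -/

namespace FreeStarAlgebra

variable {G : Type*} {D : Type*} [Ring D] [StarRing D] [Algebra ℂ D] [StarModule ℂ D]

/-- The star-homomorphism on the free star-algebra with prescribed values on the generators. -/
def lift (f : G → D) : FreeStarAlgebra G →⋆ₐ[ℂ] D where
  toAlgHom := FreeAlgebra.lift ℂ (Sum.elim f fun g => star (f g))
  map_star' x := by
    let q : FreeStarAlgebra G →ₐ[ℂ] D := FreeAlgebra.lift ℂ (Sum.elim f fun g => star (f g))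
    have hq : ∀ s, q (letter s) = Sum.elim f (fun g => star (f g)) s := fun s =>
      FreeAlgebra.lift_ι_apply _ s
    change q (star x) = star (q x)
    induction x using induction with
    | hs c =>
      rw [AlgHom.commutes, Algebra.algebraMap_eq_smul_one, star_smul, star_one, map_smul, map_one,
        Algebra.algebraMap_eq_smul_one, star_smul, star_one]
    | hl s => rw [star_letter, hq, hq]; cases s <;> simp
    | hm x y hx hy => rw [star_mul, map_mul, hx, hy, map_mul, star_mul]
    | ha x y hx hy => rw [star_add, map_add, hx, hy, map_add, star_add]

theorem lift_gen (f : G → D) (g : G) : lift f (gen g) = f g :=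
  FreeAlgebra.lift_ι_apply _ (Sum.inl g)

end FreeStarAlgebra

namespace UniversalCStarAlgebra

variable {G : Type*} {D : Type*} [CStarAlgebra D]

/-- The universal property of the C*-algebra with given generators and relations. -/
def lift (R : Set (FreeStarAlgebra G)) (hR : AdmissibleRel R) (f : G → D)
    (hf : ∀ r ∈ R, FreeStarAlgebra.lift f r = 0) : UniversalCStarAlgebra R hR →⋆ₐ[ℂ] D :=
  CStarSeminorm.Completion.lift _ (FreeStarAlgebra.lift f) fun x =>
    -- The seminorm x ↦ ‖`lift f` x‖ kills the relators, so it is one of those whose supremum is the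
    -- universal seminorm.
    CStarSeminorm.le_supremum hR.bddAbove
      (p := CStarSeminorm.ofStarAlgHom (FreeStarAlgebra.lift f))
      (fun r hr => by rw [CStarSeminorm.ofStarAlgHom_apply, hf r hr, norm_zero]) x

theorem lift_mk_gen (R : Set (FreeStarAlgebra G)) (hR : AdmissibleRel R) (f : G → D)
    (hf : ∀ r ∈ R, FreeStarAlgebra.lift f r = 0) (g : G) :
    lift R hR f hf (mk R hR (FreeStarAlgebra.gen g)) = f g :=
  (CStarSeminorm.Completion.lift_mk _ _ _ _).trans (FreeStarAlgebra.lift_gen f g)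

end UniversalCStarAlgebra

/-- The entrywise form matches the Brown relations, so unitary matrices and solutions of the
relations can be exchanged. -/
theorem Matrix.mem_unitary_iff_sum {n : ℕ} {D : Type*} [Ring D] [StarRing D]
    {U : Matrix (Fin n) (Fin n) D} :
    U ∈ unitary (Matrix (Fin n) (Fin n) D) ↔
      (∀ k l, ∑ i, star (U i k) * U i l = if k = l then 1 else 0) ∧
      ∀ i l, ∑ k, U i k * star (U l k) = if i = l then 1 else 0 := by
  rw [Unitary.mem_iff, ← Matrix.ext_iff, ← Matrix.ext_iff]
  simp only [Matrix.mul_apply, Matrix.star_apply, Matrix.one_apply]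

theorem Matrix.map_mem_unitary {n : ℕ} {C D : Type*} [Ring C] [StarRing C] [Algebra ℂ C]
    [Ring D] [StarRing D] [Algebra ℂ D] (f : C →⋆ₐ[ℂ] D) {U : Matrix (Fin n) (Fin n) C}
    (hU : U ∈ unitary (Matrix (Fin n) (Fin n) C)) :
    U.map f ∈ unitary (Matrix (Fin n) (Fin n) D) := by
  rw [Matrix.mem_unitary_iff_sum] at hU ⊢
  simp only [Matrix.map_apply, ← map_star, ← map_mul, ← map_sum, hU.1, hU.2]
  simp [apply_ite f]

namespace BrownAlgebra

variable {n : ℕ} {D : Type*} [CStarAlgebra D]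

/-- The star-homomorphism on the Brown algebra given by a unitary matrix. -/
def lift (U : Matrix (Fin n) (Fin n) D) (hU : U ∈ unitary (Matrix (Fin n) (Fin n) D)) :
    BrownAlgebra n →⋆ₐ[ℂ] D :=
  UniversalCStarAlgebra.lift _ _ (fun ij : Fin n × Fin n => U ij.1 ij.2) <| by
    rw [Matrix.mem_unitary_iff_sum] at hU
    rintro r (⟨i, l, rfl⟩ | ⟨k, l, rfl⟩)
    · simp only [map_sub, map_sum, map_mul, map_star, FreeStarAlgebra.lift_gen, hU.2]
      split_ifs <;> simp
    · simp only [map_sub, map_sum, map_mul, map_star, FreeStarAlgebra.lift_gen, hU.1]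
      split_ifs <;> simp

theorem lift_u (U : Matrix (Fin n) (Fin n) D) (hU : U ∈ unitary (Matrix (Fin n) (Fin n) D))
    (i j : Fin n) : lift U hU (u i j) = U i j :=
  UniversalCStarAlgebra.lift_mk_gen _ _ _ _ (i, j)

theorem of_u_mem_unitary :
    Matrix.of (fun i j => u i j) ∈ unitary (Matrix (Fin n) (Fin n) (BrownAlgebra n)) := by
  rw [Matrix.mem_unitary_iff_sum]
  constructor
  · intro k l
    have h := UniversalCStarAlgebra.mk_rel (brownRel_admissible n) (Or.inr ⟨k, l, rfl⟩)
    rw [map_sub, map_sum, sub_eq_zero] at h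
    simp only [map_mul, map_star] at h
    refine h.trans ?_
    split_ifs <;> simp
  · intro i l
    have h := UniversalCStarAlgebra.mk_rel (brownRel_admissible n) (Or.inl ⟨i, l, rfl⟩)
    rw [map_sub, map_sum, sub_eq_zero] at h
    simp only [map_mul, map_star] at h
    refine h.trans ?_
    split_ifs <;> simp

end BrownAlgebra

namespace CStarFreeProduct

variable {I : Type*} {A : I → Type*} [∀ i, CStarAlgebra (A i)] {D : Type*} [CStarAlgebra D]

/-- The star-homomorphism on the free product given by star-homomorphisms on the factors. -/
def lift (f : ∀ i, A i →⋆ₐ[ℂ] D) : CStarFreeProduct A →⋆ₐ[ℂ] D :=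
  UniversalCStarAlgebra.lift _ _ (fun ia : Σ i, A i => f ia.1 ia.2) <| by
    rintro r (⟨i, a, b⟩ | ⟨i, c, a⟩ | ⟨i, a, b⟩ | ⟨i, a⟩ | ⟨i⟩) <;>
      simp [FreeStarAlgebra.lift_gen, map_star]

theorem lift_of (f : ∀ i, A i →⋆ₐ[ℂ] D) (i : I) (a : A i) : lift f (of A i a) = f i a :=
  UniversalCStarAlgebra.lift_mk_gen _ _ _ _ (⟨i, a⟩ : Σ i, A i)

end CStarFreeProduct

theorem brownFreeGen_mem_unitary (m n : ℕ) (x : Fin m) :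
    brownFreeGen m n x ∈ unitary (Matrix (Fin n) (Fin n)
      (CStarFreeProduct fun _ : Fin m => BrownAlgebra n)) :=
  Matrix.map_mem_unitary (CStarFreeProduct.of (fun _ : Fin m => BrownAlgebra n) x)
    BrownAlgebra.of_u_mem_unitary

/-! ### Direct sums of representations -/

section DirectSum

variable {ι : Type*} {H : ι → Type*} [∀ i, NormedAddCommGroup (H i)]

theorem memℓp_two_of_norm_le {f g : ∀ i, H i} (hf : Memℓp f 2) (c : ℝ)
    (h : ∀ i, ‖g i‖ ≤ c * ‖f i‖) : Memℓp g 2 := by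
  refine memℓp_gen ?_
  have hs := (hf.summable (by norm_num)).mul_left (c ^ 2)
  refine hs.of_nonneg_of_le (fun i => by positivity) fun i => ?_
  have := pow_le_pow_left₀ (norm_nonneg _) (h i) 2
  simpa [mul_pow] using this

variable [∀ i, InnerProductSpace ℂ (H i)]

/-- The diagonal operator on an `ℓ²` direct sum given by a bounded family of operators. -/
def diagOp (T : ∀ i, H i →L[ℂ] H i) (c : ℝ) (hT : ∀ i, ‖T i‖ ≤ c) : lp H 2 →L[ℂ] lp H 2 :=
  LinearMap.mkContinuous
    { toFun := fun f => ⟨fun i => T i (f i),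
        memℓp_two_of_norm_le (lp.memℓp f) c fun i => (T i).le_of_opNorm_le (hT i) _⟩
      map_add' := fun f g => by
        ext i
        exact map_add (T i) (f i) (g i)
      -- The bound is `max c 0` because c may be negative when the index set is empty.
      map_smul' := fun z f => by ext i; simp } (max c 0) fun f => by
    refine lp.norm_le_of_tsum_le (by norm_num) (by positivity) ?_
    have hb : ∀ i, ‖T i (f i)‖ ≤ max c 0 * ‖f i‖ := fun i =>
      (T i).le_of_opNorm_le ((hT i).trans (le_max_left _ _)) _
    rw [Real.mul_rpow (by positivity) (norm_nonneg _), lp.norm_rpow_eq_tsum (by norm_num),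
      ← tsum_mul_left]
    have hs := (lp.memℓp f).summable (by norm_num)
    refine Summable.tsum_le_tsum (fun i => ?_)
      ((memℓp_two_of_norm_le (lp.memℓp f) _ hb).summable (by norm_num)) (hs.mul_left _)
    rw [← Real.mul_rpow (by positivity) (norm_nonneg _)]
    exact Real.rpow_le_rpow (norm_nonneg _) (hb i) (by norm_num)

theorem diagOp_apply (T : ∀ i, H i →L[ℂ] H i) (c : ℝ) (hT : ∀ i, ‖T i‖ ≤ c) (f : lp H 2) (i : ι) :
    diagOp T c hT f i = T i (f i) := rfl

variable [∀ i, CompleteSpace (H i)] {A : Type*} [CStarAlgebra A]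

/-- The `ℓ²` direct sum of a family of representations. -/
def directSumRep (π : ∀ i, A →⋆ₐ[ℂ] (H i →L[ℂ] H i)) : A →⋆ₐ[ℂ] (lp H 2 →L[ℂ] lp H 2) where
  toFun a := diagOp (fun i => π i a) ‖a‖ fun i => NonUnitalStarAlgHom.norm_apply_le (π i) a
  map_one' := by ext f i; simp [diagOp_apply]
  map_mul' a b := by ext f i; simp [diagOp_apply]
  map_zero' := by ext f i; simp [diagOp_apply]
  map_add' a b := by ext f i; simp [diagOp_apply]
  commutes' c := by ext f i; simp [diagOp_apply, Algebra.algebraMap_eq_smul_one]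
  map_star' a := by
    rw [ContinuousLinearMap.star_eq_adjoint, ContinuousLinearMap.eq_adjoint_iff]
    intro f g
    simp only [lp.inner_eq_tsum, diagOp_apply, map_star, ContinuousLinearMap.star_eq_adjoint,
      ContinuousLinearMap.adjoint_inner_left]

open Classical in
/-- The inclusion of a summand in an `ℓ²` direct sum. -/
def summandIsometry (H : ι → Type*) [∀ i, NormedAddCommGroup (H i)]
    [∀ i, InnerProductSpace ℂ (H i)] (i : ι) : H i →ₗᵢ[ℂ] lp H 2 where
  toLinearMap := lp.lsingle 2 i
  norm_map' x := lp.norm_single (by norm_num) i x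

theorem directSumRep_summandIsometry (π : ∀ i, A →⋆ₐ[ℂ] (H i →L[ℂ] H i)) (a : A) (i : ι)
    (x : H i) : directSumRep π a (summandIsometry H i x) = summandIsometry H i (π i a x) := by
  classical
  ext j
  change π j a (lp.single 2 i x j) = lp.single 2 i (π i a x) j
  rw [lp.single_apply, lp.single_apply]
  rcases eq_or_ne j i with rfl | h
  · simp
  · simp [h]

end DirectSum

/-! ### Comparison of product representations under intertwining isometries -/

section Intertwine

variable {A B : Type*} [CStarAlgebra A] [CStarAlgebra B]
  {H : Type*} [NormedAddCommGroup H] [InnerProductSpace ℂ H] [CompleteSpace H]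
  {K : Type*} [NormedAddCommGroup K] [InnerProductSpace ℂ K] [CompleteSpace K]
  {H' : Type*} [NormedAddCommGroup H'] [InnerProductSpace ℂ H'] [CompleteSpace H']
  {K' : Type*} [NormedAddCommGroup K'] [InnerProductSpace ℂ K'] [CompleteSpace K']

/-- The isometry V ⊗ W intertwines π ⊗ σ with π' ⊗ σ', so the former is a restriction of the latter
to an invariant subspace, and restriction does not increase the norm. -/
theorem norm_productRep_le_of_intertwine (π : A →⋆ₐ[ℂ] (H →L[ℂ] H)) (σ : B →⋆ₐ[ℂ] (K →L[ℂ] K))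
    (π' : A →⋆ₐ[ℂ] (H' →L[ℂ] H')) (σ' : B →⋆ₐ[ℂ] (K' →L[ℂ] K'))
    (V : H →ₗᵢ[ℂ] H') (W : K →ₗᵢ[ℂ] K') (hV : ∀ a x, π' a (V x) = V (π a x))
    (hW : ∀ b y, σ' b (W y) = W (σ b y)) (x : A ⊗[ℂ] B) :
    ‖productRep π σ x‖ ≤ ‖productRep π' σ' x‖ := by
  -- Operators from the algebraic tensor product preserve algebraic tensors of vectors. The
  -- intertwining relation is therefore checked there, with no need to extend V ⊗ W to the
  -- completions.
  have hex : ∀ z : H ⊗[ℂ] K, ∃ w : H ⊗[ℂ] K,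
      productRep π σ x (z : HilbertTensor H K) = (w : HilbertTensor H K) ∧
      productRep π' σ' x ((TensorProduct.mapIsometry V W z : H' ⊗[ℂ] K') : HilbertTensor H' K') =
        ((TensorProduct.mapIsometry V W w : H' ⊗[ℂ] K') : HilbertTensor H' K') := fun z => by
    induction x with
    | zero =>
      refine ⟨0, ?_, ?_⟩
      · rw [map_zero, zero_apply, UniformSpace.Completion.coe_zero]
      · rw [map_zero, map_zero, zero_apply, UniformSpace.Completion.coe_zero]
    | add x y hx hy =>
      obtain ⟨w, h1, h2⟩ := hx
      obtain ⟨w', h1', h2'⟩ := hy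
      refine ⟨w + w', ?_, ?_⟩
      · rw [map_add, add_apply, h1, h1', UniformSpace.Completion.coe_add]
      · rw [map_add, add_apply, h2, h2', map_add, UniformSpace.Completion.coe_add]
    | tmul a b =>
      refine ⟨TensorProduct.mapL (π a) (σ b) z, ?_, ?_⟩
      · rw [productRep_tmul, opTensor_coe]
      · rw [productRep_tmul, opTensor_coe]
        congr 1
        induction z with
        | zero => simp only [map_zero]
        | add z z' hz hz' => simp only [map_add, hz, hz']
        | tmul y y' =>
          change TensorProduct.mapL (π' a) (σ' b) (V y ⊗ₜ W y') = _
          rw [TensorProduct.mapL_tmul, TensorProduct.mapL_tmul, hV, hW]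
          rfl
  refine ContinuousLinearMap.opNorm_le_bound _ (ContinuousLinearMap.opNorm_nonneg _) fun z => ?_
  induction z using UniformSpace.Completion.induction_on with
  | hp => exact isClosed_le (by fun_prop) (by fun_prop)
  | ih z =>
    obtain ⟨w, h1, h2⟩ := hex z
    have h := (productRep π' σ' x).le_opNorm
      ((TensorProduct.mapIsometry V W z : H' ⊗[ℂ] K') : HilbertTensor H' K')
    rw [h2, UniformSpace.Completion.norm_coe, UniformSpace.Completion.norm_coe,
      LinearIsometry.norm_map, LinearIsometry.norm_map] at h
    rwa [h1, UniformSpace.Completion.norm_coe, UniformSpace.Completion.norm_coe]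

end Intertwine

/-! ### Attaining the minimal norm -/

section MinTensorRep

universe v w

variable {A : Type u} [CStarAlgebra A] {B : Type v} [CStarAlgebra B]

theorem norm_productRep_le {H : Type (max u w)} [NormedAddCommGroup H] [InnerProductSpace ℂ H]
    [CompleteSpace H] {K : Type (max v w)} [NormedAddCommGroup K] [InnerProductSpace ℂ K]
    [CompleteSpace K] (π : A →⋆ₐ[ℂ] (H →L[ℂ] H)) (σ : B →⋆ₐ[ℂ] (K →L[ℂ] K)) (x : A ⊗[ℂ] B) :
    ‖productRep π σ x‖ ≤ minSeminorm.{u, v, w} A B x :=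
  have hmem : CStarSeminorm.ofStarAlgHom (D := HilbertTensor H K →L[ℂ] HilbertTensor H K)
      (productRep π σ) ∈ spatialSeminorms.{u, v, w} A B :=
    ⟨H, _, _, ‹_›, K, _, _, ‹_›, π, σ, rfl⟩
  CStarSeminorm.le_supremum (spatialSeminorms_bddAbove.{u, v, w} A B) hmem x

theorem exists_lt_norm_productRep (x : A ⊗[ℂ] B) {c : ℝ} (hc0 : 0 ≤ c)
    (hc : c < minSeminorm.{u, v, w} A B x) :
    ∃ (H : Type (max u w)) (_ : NormedAddCommGroup H) (_ : InnerProductSpace ℂ H)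
      (_ : CompleteSpace H) (K : Type (max v w)) (_ : NormedAddCommGroup K)
      (_ : InnerProductSpace ℂ K) (_ : CompleteSpace K)
      (π : A →⋆ₐ[ℂ] (H →L[ℂ] H)) (σ : B →⋆ₐ[ℂ] (K →L[ℂ] K)), c < ‖productRep π σ x‖ := by
  by_contra! h
  refine hc.not_ge (CStarSeminorm.supremum_le _ hc0 ?_)
  rintro _ ⟨H, _, _, _, K, _, _, _, π, σ, rfl⟩
  exact h H _ _ _ K _ _ _ π σ

/-- The minimal norm is attained by a single pair of representations. -/
theorem exists_norm_productRep_eq (A : Type u) [CStarAlgebra A] (B : Type v) [CStarAlgebra B] :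
    ∃ (H : Type (max u v w)) (_ : NormedAddCommGroup H) (_ : InnerProductSpace ℂ H)
      (_ : CompleteSpace H) (K : Type (max u v w)) (_ : NormedAddCommGroup K)
      (_ : InnerProductSpace ℂ K) (_ : CompleteSpace K)
      (π : A →⋆ₐ[ℂ] (H →L[ℂ] H)) (σ : B →⋆ₐ[ℂ] (K →L[ℂ] K)),
      ∀ x, minSeminorm.{u, v, w} A B x ≤ ‖productRep π σ x‖ := by
  -- One pair of representations is chosen for each tensor x and each c below its minimal norm. Both
  -- direct sums run over this same index set, so the tensor product of the sums contains every H i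
  -- ⊗ K i.
  let ι := {i : (A ⊗[ℂ] B) × ℝ // 0 ≤ i.2 ∧ i.2 < minSeminorm.{u, v, w} A B i.1}
  choose H i1 i2 i3 K i4 i5 i6 π σ h using fun i : ι =>
    exists_lt_norm_productRep.{u, v, w} i.1.1 i.2.1 i.2.2
  refine ⟨lp H 2, inferInstance, inferInstance, inferInstance, lp K 2, inferInstance, inferInstance,
    inferInstance, directSumRep π, directSumRep σ, fun x => ?_⟩
  refine le_of_forall_lt fun c hc => ?_
  -- Negative c are not indices, but any norm exceeds them.
  rcases lt_or_ge c 0 with hc0 | hc0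
  · exact hc0.trans_le (ContinuousLinearMap.opNorm_nonneg _)
  · let i : ι := ⟨(x, c), hc0, hc⟩
    exact (h i).trans_le (norm_productRep_le_of_intertwine _ _ _ _ (summandIsometry H i)
      (summandIsometry K i) (fun a y => directSumRep_summandIsometry π a i y)
      (fun a y => directSumRep_summandIsometry σ a i y) x)

end MinTensorRep

/-! ### Star-homomorphisms on the minimal tensor product -/

section Operators

variable {L : Type*} [NormedAddCommGroup L] [InnerProductSpace ℂ L] [CompleteSpace L]

namespace CStarSeminorm.Completion
variable {F : Type*} [Ring F] [StarRing F] [Algebra ℂ F] [StarModule ℂ F]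
/-- The extension to the C*-completion of a representation dominated by the seminorm. -/
def liftRep (p : CStarSeminorm F) (f : F →⋆ₐ[ℂ] (L →L[ℂ] L)) (hf : ∀ x, ‖f x‖ ≤ p x) :
    p.Completion →⋆ₐ[ℂ] (L →L[ℂ] L) :=
  lift p f hf

theorem liftRep_mk (p : CStarSeminorm F) (f : F →⋆ₐ[ℂ] (L →L[ℂ] L))
    (hf : ∀ x, ‖f x‖ ≤ p x) (x : F) :
    liftRep p f hf (mk p x) = f x :=
  lift_mk p f hf x

theorem norm_liftRep (p : CStarSeminorm F) (f : F →⋆ₐ[ℂ] (L →L[ℂ] L))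
    (hf : ∀ x, ‖f x‖ = p x) (x : p.Completion) :
    ‖liftRep p f (fun x => (hf x).le) x‖ = ‖x‖ :=
  norm_lift p f hf x

end CStarSeminorm.Completion

theorem QState.exists_comap_eq_rep {C : Type*} [CStarAlgebra C] (ρ : C →⋆ₐ[ℂ] (L →L[ℂ] L))
    (hρ : ∀ x, ‖ρ x‖ = ‖x‖) (ψ : QState C) :
    ∃ χ : QState (L →L[ℂ] L), ∀ x, χ (ρ x) = ψ x :=
  exists_comap_eq ρ hρ ψ
end Operators
namespace MinTensor

section Rep

universe v w

variable {A : Type u} [CStarAlgebra A] {B : Type v} [CStarAlgebra B]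
  {H : Type (max u w)} [NormedAddCommGroup H] [InnerProductSpace ℂ H] [CompleteSpace H]
  {K : Type (max v w)} [NormedAddCommGroup K] [InnerProductSpace ℂ K] [CompleteSpace K]

/-- The representation `π ⊗ σ` of the minimal tensor product. -/
def rep (π : A →⋆ₐ[ℂ] (H →L[ℂ] H)) (σ : B →⋆ₐ[ℂ] (K →L[ℂ] K)) :
    MinTensor.{u, v, w} A B →⋆ₐ[ℂ] (HilbertTensor H K →L[ℂ] HilbertTensor H K) :=
  CStarSeminorm.Completion.liftRep _
    (productRep π σ) (norm_productRep_le.{u, v, w} π σ)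

theorem rep_tmul (π : A →⋆ₐ[ℂ] (H →L[ℂ] H)) (σ : B →⋆ₐ[ℂ] (K →L[ℂ] K)) (a : A) (b : B) :
    rep.{u, v, w} π σ (tmul a b) = opTensor (π a) (σ b) :=
  (CStarSeminorm.Completion.liftRep_mk _ _ _ _).trans
    (productRep_tmul π σ a b)

theorem norm_rep (π : A →⋆ₐ[ℂ] (H →L[ℂ] H)) (σ : B →⋆ₐ[ℂ] (K →L[ℂ] K))
    (h : ∀ x, minSeminorm.{u, v, w} A B x ≤ ‖productRep π σ x‖) (x : MinTensor.{u, v, w} A B) :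
    ‖rep.{u, v, w} π σ x‖ = ‖x‖ :=
  CStarSeminorm.Completion.norm_liftRep _
    (productRep π σ) (fun x => (norm_productRep_le.{u, v, w} π σ x).antisymm (h x)) x

end Rep
section Map

variable {C D : Type} [CStarAlgebra C] [CStarAlgebra D] {A B : Type u} [CStarAlgebra A]
  [CStarAlgebra B]

/-- Composing with f and g turns each pair of representations of `A`, `B` into a pair for `C`, `D`,
so the right-hand supremum covers the left-hand one. The third universe of the norm on `C ⊗ D` is
`u` so that Hilbert spaces in `Type u` are included. -/
theorem norm_mk_tensorMap_le (f : C →⋆ₐ[ℂ] A) (g : D →⋆ₐ[ℂ] B) (x : C ⊗[ℂ] D) :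
    minSeminorm.{u, u, u} A B (Algebra.TensorProduct.map f.toAlgHom g.toAlgHom x) ≤
      minSeminorm.{0, 0, u} C D x := by
  refine CStarSeminorm.supremum_le _ (CStarSeminorm.nonneg _ _) ?_
  rintro _ ⟨H, _, _, _, K, _, _, _, π, σ, rfl⟩
  have h : productRep π σ (Algebra.TensorProduct.map f.toAlgHom g.toAlgHom x) =
      productRep (π.comp f) (σ.comp g) x := by
    induction x with
    | zero => simp only [map_zero]
    | add x y hx hy => simp only [map_add, hx, hy]
    | tmul a b =>
      rw [Algebra.TensorProduct.map_tmul, productRep_tmul, productRep_tmul]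
      rfl
  rw [CStarSeminorm.ofStarAlgHom_apply, h]
  exact norm_productRep_le.{0, 0, u} (π.comp f) (σ.comp g) x

/-- The star-homomorphism `f ⊗ g` of minimal tensor products. -/
def map (f : C →⋆ₐ[ℂ] A) (g : D →⋆ₐ[ℂ] B) :
    MinTensor.{0, 0, u} C D →⋆ₐ[ℂ] MinTensor.{u, u, u} A B :=
  CStarSeminorm.Completion.lift _
    ((CStarSeminorm.Completion.mk (minSeminorm.{u, u, u} A B)).comp
      { Algebra.TensorProduct.map f.toAlgHom g.toAlgHom with
        map_star' := fun x => by
          change Algebra.TensorProduct.map f.toAlgHom g.toAlgHom (star x) =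
            star (Algebra.TensorProduct.map f.toAlgHom g.toAlgHom x)
          induction x with
          | zero => simp only [star_zero, map_zero]
          | add x y hx hy => simp only [star_add, map_add, hx, hy]
          | tmul a b =>
            rw [TensorProduct.star_tmul, Algebra.TensorProduct.map_tmul,
              Algebra.TensorProduct.map_tmul, TensorProduct.star_tmul]
            exact congrArg₂ _ (map_star f a) (map_star g b) })
    fun x => (CStarSeminorm.Completion.norm_mk _ _).trans_le (norm_mk_tensorMap_le f g x)

theorem map_tmul (f : C →⋆ₐ[ℂ] A) (g : D →⋆ₐ[ℂ] B) (a : C) (b : D) :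
    map f g (tmul a b) = tmul (f a) (g b) :=
  CStarSeminorm.Completion.lift_mk _ _ _ _

/-- Every state on the minimal tensor product extends to a state on `B(H ⊗ K)` for suitable faithful
representations. -/
theorem exists_state_opTensor {C D : Type} [CStarAlgebra C] [CStarAlgebra D]
    (ψ : QState (MinTensor.{0, 0, u} C D)) :
    ∃ (H : Type u) (_ : NormedAddCommGroup H) (_ : InnerProductSpace ℂ H) (_ : CompleteSpace H)
      (K : Type u) (_ : NormedAddCommGroup K) (_ : InnerProductSpace ℂ K) (_ : CompleteSpace K)
      (π : C →⋆ₐ[ℂ] (H →L[ℂ] H)) (σ : D →⋆ₐ[ℂ] (K →L[ℂ] K))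
      (χ : QState (HilbertTensor H K →L[ℂ] HilbertTensor H K)),
      ∀ a b, ψ (MinTensor.tmul a b) = χ (opTensor (π a) (σ b)) := by
  obtain ⟨H, _, _, _, K, _, _, _, π, σ, hπσ⟩ := exists_norm_productRep_eq.{0, 0, u} C D
  obtain ⟨χ, hχ⟩ := QState.exists_comap_eq_rep (MinTensor.rep.{0, 0, u} π σ)
    (MinTensor.norm_rep.{0, 0, u} π σ hπσ) ψ
  exact ⟨H, _, _, ‹_›, K, _, _, ‹_›, π, σ, χ, fun a b =>
    (hχ _).symm.trans (congrArg χ (MinTensor.rep_tmul.{0, 0, u} π σ a b))⟩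

end Map

end MinTensor

/-! ### The channel formula -/

theorem sum_mul_sum_mul_mul_sum_mul_sum {R ι : Type*} [Semiring R] [Fintype ι]
    (a b c d : ι → ι → R) (G : R) :
    (∑ i, ∑ j, a i j) * (∑ p, ∑ r, b p r) * G * (∑ s, ∑ t, c s t) * (∑ k, ∑ l, d k l) =
      ∑ i, ∑ j, ∑ k, ∑ l, ∑ p, ∑ r, ∑ s, ∑ t, a i j * b p r * G * c s t * d k l := by
  simp only [← Finset.sum_mul, ← Finset.mul_sum]

section Channels

variable {n : ℕ} {H : Type*} [NormedAddCommGroup H] [InnerProductSpace ℂ H] [CompleteSpace H]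
  {K : Type*} [NormedAddCommGroup K] [InnerProductSpace ℂ K] [CompleteSpace K]

/-- Multilinear expansion reduces everything to elementary tensors: the outer legs multiply to the
matrices seen by φ, and the middle leg to the ordered product u v v' u' seen by ψ. The four families
are arbitrary, since neither commutation nor unitarity is used yet. -/
theorem wholeState_conj {L : Type*} [NormedAddCommGroup L] [InnerProductSpace ℂ L] [CompleteSpace L]
    (φ : QState (Ancilla n)) (ψ : QState (L →L[ℂ] L)) (u v v' u' : Fin n → Fin n → (L →L[ℂ] L))
    (g h : Matrix (Fin n) (Fin n) ℂ) :
    wholeState φ ψ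
      (((∑ i, ∑ j, (Matrix.single i j (1 : ℂ) ⊗ₜ[ℂ] u i j) ⊗ₜ[ℂ] 1 : WholeSystem n (L →L[ℂ] L)) *
        (∑ p, ∑ r, (1 ⊗ₜ[ℂ] v p r) ⊗ₜ[ℂ] Matrix.single p r (1 : ℂ) : WholeSystem n (L →L[ℂ] L)) *
        ((g ⊗ₜ[ℂ] 1) ⊗ₜ[ℂ] h) *
        (∑ s, ∑ t, (1 ⊗ₜ[ℂ] v' s t) ⊗ₜ[ℂ] Matrix.single s t (1 : ℂ) : WholeSystem n (L →L[ℂ] L)) *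
        (∑ k, ∑ l, (Matrix.single k l (1 : ℂ) ⊗ₜ[ℂ] u' k l) ⊗ₜ[ℂ] 1 :
          WholeSystem n (L →L[ℂ] L)) : WholeSystem n (L →L[ℂ] L))) =
      ∑ i, ∑ j, ∑ k, ∑ l, ∑ p, ∑ r, ∑ s, ∑ t,
        φ ((Matrix.single i j 1 * g * Matrix.single k l 1) ⊗ₜ[ℂ]
            (Matrix.single p r 1 * h * Matrix.single s t 1)) *
          ψ (u i j * v p r * v' s t * u' k l) := by
  refine (congrArg (wholeState φ ψ) (sum_mul_sum_mul_mul_sum_mul_sum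
    (R := WholeSystem n (L →L[ℂ] L)) _ _ _ _ _)).trans ?_
  simp only [map_sum]
  refine Finset.sum_congr rfl fun i _ => Finset.sum_congr rfl fun j _ =>
    Finset.sum_congr rfl fun k _ => Finset.sum_congr rfl fun l _ => Finset.sum_congr rfl fun p _ =>
    Finset.sum_congr rfl fun r _ => Finset.sum_congr rfl fun s _ =>
    Finset.sum_congr rfl fun t _ => ?_
  simp only [Algebra.TensorProduct.tmul_mul_tmul, one_mul, mul_one]
  rfl

theorem wholeState_aliceOp_bobOp (φ : QState (Ancilla n))
    (ψ : QState (HilbertTensor H K →L[ℂ] HilbertTensor H K))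
    (U : Matrix (Fin n) (Fin n) (H →L[ℂ] H)) (V : Matrix (Fin n) (Fin n) (K →L[ℂ] K))
    (g h : Matrix (Fin n) (Fin n) ℂ) :
    wholeState φ ψ (aliceOp K U * bobOp H V * ((g ⊗ₜ[ℂ] 1) ⊗ₜ[ℂ] h) *
        bobOp H (star V) * aliceOp K (star U)) =
      ∑ i, ∑ j, ∑ k, ∑ l, ∑ p, ∑ r, ∑ s, ∑ t,
        φ ((Matrix.single i j 1 * g * Matrix.single k l 1) ⊗ₜ[ℂ]
            (Matrix.single p r 1 * h * Matrix.single s t 1)) *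
          ψ (opTensor (U i j * star (U l k)) (V p r * star (V t s))) := by
  -- Bob's factors merge first, then commute past Alice's last factor. The reversed indices (l, k)
  -- and (t, s) come from the entries of the adjoint matrices.
  have hamp : ∀ i j k l p r s t,
      ampLeft H K (U i j) * ampRight H K (V p r) * ampRight H K (star V s t) *
        ampLeft H K (star U k l) = opTensor (U i j * star (U l k)) (V p r * star (V t s)) :=
      fun i j k l p r s t => by
    rw [mul_assoc _ (ampRight H K (V p r)), ← map_mul, mul_assoc, ampRight_mul_ampLeft,
      ← ampLeft_mul_ampRight, ← mul_assoc, ← map_mul, ampLeft_mul_ampRight]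
    rfl
  simp only [← hamp]
  exact wholeState_conj φ ψ (fun i j => ampLeft H K (U i j)) (fun p r => ampRight H K (V p r))
    (fun s t => ampRight H K (star V s t)) (fun k l => ampLeft H K (star U k l)) g h

end Channels

/-! ### The three implications -/

variable {m n : ℕ} {Λ : Fin m → Fin m → QState (Ancilla n) → QState (Ancilla n)}

theorem IsGeneralizedUnitaryInducedTensor.exists_isGivenByMinState
    (hΛ : IsGeneralizedUnitaryInducedTensor.{u} m n Λ) :
    ∃ (A : Type u) (_ : CStarAlgebra A) (B : Type u) (_ : CStarAlgebra B)
      (ψ : QState (MinTensor.{u, u, u} A B))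
      (U : Fin m → Matrix (Fin n) (Fin n) A) (V : Fin m → Matrix (Fin n) (Fin n) B),
      (∀ x, U x ∈ unitary (Matrix (Fin n) (Fin n) A)) ∧
      (∀ y, V y ∈ unitary (Matrix (Fin n) (Fin n) B)) ∧
      IsGivenByMinState Λ ψ U V := by
  obtain ⟨H, _, _, _, K, _, _, _, ψ, U, V, hU, hV, hΛ⟩ := hΛ
  -- The product of the identity representations is one of the pairs defining the minimal norm, so
  -- it extends to B(H) ⊗_min B(K). It need not be isometric, as the state is only pulled back.
  refine ⟨H →L[ℂ] H, inferInstance, K →L[ℂ] K, inferInstance,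
    ψ.comap (MinTensor.rep.{u, u, u} (StarAlgHom.id ℂ (H →L[ℂ] H)) (StarAlgHom.id ℂ (K →L[ℂ] K))),
    U, V, hU, hV, fun x y φ g h => ?_⟩
  rw [hΛ, wholeState_aliceOp_bobOp]
  simp only [QState.comap_apply, MinTensor.rep_tmul]
  rfl

theorem IsGivenByMinState.exists_brownFreeGen {A B : Type u} [CStarAlgebra A] [CStarAlgebra B]
    {ψ : QState (MinTensor.{u, u, u} A B)} {U : Fin m → Matrix (Fin n) (Fin n) A}
    {V : Fin m → Matrix (Fin n) (Fin n) B} (hΛ : IsGivenByMinState Λ ψ U V)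
    (hU : ∀ x, U x ∈ unitary (Matrix (Fin n) (Fin n) A))
    (hV : ∀ y, V y ∈ unitary (Matrix (Fin n) (Fin n) B)) :
    ∃ χ : QState (MinTensor.{0, 0, u} (CStarFreeProduct fun _ : Fin m => BrownAlgebra n)
        (CStarFreeProduct fun _ : Fin m => BrownAlgebra n)),
      IsGivenByMinState Λ χ (brownFreeGen m n) (brownFreeGen m n) := by
  -- The two homomorphisms send the generators to the entries of U x and V y, so the pulled-back
  -- state takes the same values in the channel formula.
  refine ⟨ψ.comap (MinTensor.map
    (CStarFreeProduct.lift fun x => BrownAlgebra.lift (U x) (hU x))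
    (CStarFreeProduct.lift fun y => BrownAlgebra.lift (V y) (hV y))), fun x y φ g h => ?_⟩
  rw [hΛ]
  simp only [QState.comap_apply, MinTensor.map_tmul, map_mul, map_star, brownFreeGen,
    Matrix.of_apply, CStarFreeProduct.lift_of, BrownAlgebra.lift_u]

/-- The extended state agrees with ψ on elementary tensors, and the channel formula involves no
others. Nothing about free products is used beyond the unitarity of the two families. -/
theorem IsGivenByMinState.isGeneralizedUnitaryInducedTensor {C D : Type} [CStarAlgebra C]
    [CStarAlgebra D] {ψ : QState (MinTensor.{0, 0, u} C D)} {U : Fin m → Matrix (Fin n) (Fin n) C}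
    {V : Fin m → Matrix (Fin n) (Fin n) D} (hΛ : IsGivenByMinState Λ ψ U V)
    (hU : ∀ x, U x ∈ unitary (Matrix (Fin n) (Fin n) C))
    (hV : ∀ y, V y ∈ unitary (Matrix (Fin n) (Fin n) D)) :
    IsGeneralizedUnitaryInducedTensor.{u} m n Λ := by
  obtain ⟨H, _, _, _, K, _, _, _, π, σ, χ, hχ⟩ := MinTensor.exists_state_opTensor.{u} ψ
  refine ⟨H, _, _, inferInstance, K, _, _, inferInstance, χ, fun x => (U x).map π,
    fun y => (V y).map σ, fun x => Matrix.map_mem_unitary π (hU x),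
    fun y => Matrix.map_mem_unitary σ (hV y), fun x y φ g h => ?_⟩
  rw [hΛ, wholeState_aliceOp_bobOp]
  have hterm : ∀ i j k l p r s t,
      ψ (MinTensor.tmul (U x i j * star (U x l k)) (V y p r * star (V y t s))) =
        χ (opTensor ((U x).map π i j * star ((U x).map π l k))
          ((V y).map σ p r * star ((V y).map σ t s))) := fun i j k l p r s t => by
    rw [hχ, map_mul, map_mul, map_star, map_star]
    rfl
  simp only [hterm]

end

theorem mainTheorem6 (m n : ℕ)
    (Λ : Fin m → Fin m → QState (Ancilla n) → QState (Ancilla n)) :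
    List.TFAE [
      IsGeneralizedUnitaryInducedTensor.{u} m n Λ,
      ∃ (A : Type u) (_ : CStarAlgebra A) (B : Type u) (_ : CStarAlgebra B)
        (ψ : QState (MinTensor.{u, u, u} A B))
        (U : Fin m → Matrix (Fin n) (Fin n) A) (V : Fin m → Matrix (Fin n) (Fin n) B),
        (∀ x, U x ∈ unitary (Matrix (Fin n) (Fin n) A)) ∧
        (∀ y, V y ∈ unitary (Matrix (Fin n) (Fin n) B)) ∧
        IsGivenByMinState Λ ψ U V,
      ∃ ψ : QState (MinTensor.{0, 0, u} (CStarFreeProduct fun _ : Fin m => BrownAlgebra n)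
          (CStarFreeProduct fun _ : Fin m => BrownAlgebra n)),
        IsGivenByMinState Λ ψ (brownFreeGen m n) (brownFreeGen m n)] := by
  tfae_have 1 → 2 := fun hΛ => hΛ.exists_isGivenByMinState
  tfae_have 2 → 3 := by
    rintro ⟨A, _, B, _, ψ, U, V, hU, hV, hΛ⟩
    exact hΛ.exists_brownFreeGen hU hV
  tfae_have 3 → 1 := by
    rintro ⟨ψ, hΛ⟩
    exact hΛ.isGeneralizedUnitaryInducedTensor (brownFreeGen_mem_unitary m n)
      (brownFreeGen_mem_unitary m n)
  tfae_finish
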